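/- Let $\mathbb{E}$ be pseudo-Euclidean space: a finite-dimensional real vector space with a non-degenerate symmetric bilinear form $\langle\cdot,\cdot\rangle$ of arbitrary signature; write $x^2=\langle x,x\rangle$. Fix $\bar p\in\mathbb{E}$, an orthogonal direct sum decomposition $T_{\bar p}\mathbb{E}=\mathbb{E}=V_0\oplus V_1\oplus\dots\oplus V_k$ into non-zero (hence non-degenerate) subspaces with $k\ge 1$, and pairwise orthogonal $a_1,\dots,a_k\in V_0$. Put $\kappa_i=a_i^2$ and $\epsilon_i=\operatorname{sgn}\kappa_i$ (with $\operatorname{sgn}0=0$). Consider one of two cases. (Non-null case) $\kappa_i\neq 0$ for all $i$. Put $c=\bar p-\sum_{i=1}^k a_i/\kappa_i$. (Null case) $k=1$, $a:=a_1\ne 0$ and $a^2=0$. Then there are lightlike $b\in V_0$ with $\langle a,b\rangle=1$; fix any such $b$ and put $c=\bar p-b$. Let $N_0=c+\{p\in V_0:\langle a_i,p\rangle>0\text{ for all }i\}$, an open subset of the plane $\bar p+V_0$. For $i\ge1$ let $W_i=\mathbb{R}a_i\oplus V_i$ and let $N_i$ be the spherical submanifold determined by $(\bar p,V_i,a_i)$,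 namely $$N_i=\Big(\bar p-\frac{a_i}{\kappa_i}\Big)+\Big\{p\in W_i: p^2=\frac1{\kappa_i}\Big\}\ \text{ in the non-null case},\qquad N_1=\bar p+\Big\{p-\tfrac12p^2a: p\in V_1\Big\}\ \text{ in the null case}.$$ Each $N_j$, $0\le j\le k$, is an embedded pseudo-Riemannian submanifold of $\mathbb{E}$ of dimension $\dim V_j$ that contains $\bar p$ and has tangent space $V_j$ there; for $i\ge 1$, $N_i$ is spherical (umbilical with parallel mean curvature vector field) with mean curvature vector $-a_i$ at $\bar p$. For $i\ge1$ let $$\rho_i:N_0\to\mathbb{R}_+,\qquad \rho_i(p_0)=\langle a_i,p_0-c\rangle=1+\langle a_i,p_0-\bar p\rangle .$$ The warped product $N_0\times_{\rho_1}N_1\times\dots\times_{\rho_k}N_k$ is the product manifold with the metric $\pi_0^*g_0+\sum_{i=1}^k\rho_i^2\,\pi_i^*g_i$, where $g_j$ is the metric induced on $N_j$ and $\pi_j$ is the projection to $N_j$. Then the map $$\psi:N_0\times_{\rho_1}N_1\times\dots\times_{\rho_k}N_k\to\mathbb{E},\qquad \psi(p_0,\dots,p_k)=p_0+\sum_{i=1}^k\rho_i(p_0)(p_i-\bar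 p),$$ is an isometry (a diffeomorphism that preserves the metrics) onto the open set $$\operatorname{Im}(\psi)=\begin{cases}c+\{p\in\mathbb{E}:\operatorname{sgn}\,(P_ip)^2=\epsilon_i\text{ for }i=1,\dots,k\}&\text{in the non-null case},\\ c+\{p\in\mathbb{E}:\langle a,p\rangle>0\}&\text{in the null case},\end{cases}$$ where in the non-null case $W_i$ is non-degenerate and $P_i:\mathbb{E}\to W_i$ is the orthogonal projection. In the non-null case, $\operatorname{Im}(\psi)$ is dense in $\mathbb{E}$ if and only if $\langle\cdot,\cdot\rangle$ is positive definite or negative definite on each $W_i$, $i=1,\dots,k$. In the null case $\operatorname{Im}(\psi)$ is not dense. -/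

import Mathlib

open scoped ContDiff Topology

namespace WarpedPE

/-! ### Submanifolds of a vector space: smooth maps, tangent vectors, isometries -/

section Submanifolds

variable {F : Type*} [NormedAddCommGroup F] [NormedSpace ℝ F]
variable {E : Type*} [NormedAddCommGroup E] [NormedSpace ℝ E]

/-- A map defined on a subset `S` of a vector space is smooth if near each point of `S`
it is the restriction of a `C^∞` map defined on an open set of the ambient space. -/
def IsSmoothOn (f : F → E) (S : Set F) : Prop :=
  ∀ x ∈ S, ∃ U : Set F, IsOpen U ∧ x ∈ U ∧
    ∃ h : F → E, ContDiffOn ℝ ∞ h U ∧ Set.EqOn f h (S ∩ U)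

/-- `S` is an embedded smooth submanifold of dimension `m`: every point of `S` has a relatively
open neighbourhood in `S` that is diffeomorphic to an open subset of `ℝ^m`. -/
def IsEmbeddedSubmanifold (S : Set E) (m : ℕ) : Prop :=
  ∀ x ∈ S, ∃ U : Set E, IsOpen U ∧ x ∈ U ∧
    ∃ O : Set (EuclideanSpace ℝ (Fin m)), IsOpen O ∧
      ∃ (φ : EuclideanSpace ℝ (Fin m) → E) (χ : E → EuclideanSpace ℝ (Fin m)),
        ContDiffOn ℝ ∞ φ O ∧ IsSmoothOn χ (S ∩ U) ∧
        Set.BijOn φ O (S ∩ U) ∧ Set.LeftInvOn χ φ O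

/-- `γ` is (near time `0`) a smooth curve lying in `S`, with `γ 0 = p`. -/
def IsCurveIn (S : Set F) (p : F) (γ : ℝ → F) : Prop :=
  γ 0 = p ∧ ∃ ε > 0, ContDiffOn ℝ ∞ γ (Set.Ioo (-ε) ε) ∧ ∀ t ∈ Set.Ioo (-ε) ε, γ t ∈ S

/-- The tangent space of `S` at `p`: the velocities of smooth curves in `S` through `p`. -/
def tangentSpace (S : Set F) (p : F) : Set F :=
  {v | ∃ γ : ℝ → F, IsCurveIn S p γ ∧ deriv γ 0 = v}

/-- `f` is an isometry of the submanifold `M` with metric `gM` (a form on tangent vectors at each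
point of `M`) onto the submanifold `T` with metric `gT`: a diffeomorphism of `M` onto `T`
whose differential `γ'(0) ↦ (f ∘ γ)'(0)` carries `gM` to `gT`. -/
structure IsIsometryOnto (M : Set F) (gM : F → F → F → ℝ) (T : Set E) (gT : E → E → E → ℝ)
    (f : F → E) : Prop where
  bijOn : Set.BijOn f M T
  smooth : IsSmoothOn f M
  smooth_inv : ∃ h : E → F, IsSmoothOn h T ∧ Set.LeftInvOn h f M
  metric : ∀ p ∈ M, ∀ γ δ : ℝ → F, IsCurveIn M p γ → IsCurveIn M p δ →
    gT (f p) (deriv (f ∘ γ) 0) (deriv (f ∘ δ) 0) = gM p (deriv γ 0) (deriv δ 0)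

/-- `S` is an embedded submanifold of dimension `m` on whose tangent spaces the scalar product `g`
of the ambient space is non-degenerate. -/
structure IsPseudoRiemannianSubmanifold (g : LinearMap.BilinForm ℝ E) (S : Set E) (m : ℕ) :
    Prop where
  embedded : IsEmbeddedSubmanifold S m
  nondegenerate : ∀ p ∈ S, ∀ v ∈ tangentSpace S p,
    (∀ w ∈ tangentSpace S p, g v w = 0) → v = 0

/-- `S` is a spherical submanifold of the flat space `(E, g)` with mean curvature vector field `H`:
`H` is a smooth normal field, the normal part of the acceleration of any curve `γ` in `S` is
`⟨γ', γ'⟩ H` (that is, `S` is umbilical), and `H` is parallel in the normal bundle. -/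
structure IsSphericalSubmanifold (g : LinearMap.BilinForm ℝ E) (S : Set E) (H : E → E) :
    Prop where
  smooth : IsSmoothOn H S
  normal : ∀ p ∈ S, ∀ v ∈ tangentSpace S p, g (H p) v = 0
  umbilical : ∀ p ∈ S, ∀ γ : ℝ → E, IsCurveIn S p γ →
    deriv (deriv γ) 0 - g (deriv γ 0) (deriv γ 0) • H p ∈ tangentSpace S p
  parallel : ∀ p ∈ S, ∀ γ : ℝ → E, IsCurveIn S p γ →
    deriv (H ∘ γ) 0 ∈ tangentSpace S p

end Submanifolds

/-! ### The objects of the construction -/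

section Objects

variable {E : Type*} [NormedAddCommGroup E] [NormedSpace ℝ E]

open Classical in
/-- The spherical submanifold determined by `(p, V, a)`, where `V` is non-degenerate and `a ⟂ V`:
the plane `p + V` if `a = 0`, a paraboloid if `a` is lightlike, and otherwise the central
hyperquadric in `ℝ a ⊕ V` with `x² = 1 / a²`, translated to the centre `p - a / a²`. -/
noncomputable def sphere (g : LinearMap.BilinForm ℝ E) (p : E) (V : Submodule ℝ E) (a : E) :
    Set E :=
  if a = 0 then {x | x - p ∈ V}
  else if g a a = 0 then {x | ∃ v ∈ V, x = p + (v - ((1 / 2 : ℝ) * g v v) • a)}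
  else {x | ∃ w ∈ (ℝ ∙ a) ⊔ V, g w w = 1 / g a a ∧ x = p - (1 / g a a) • a + w}

open Classical in
/-- The orthogonal projection of `E` onto a subspace `W` with `E = W ⊕ W^⟂`
(set to `0` if this decomposition fails). -/
noncomputable def orthProj (g : LinearMap.BilinForm ℝ E) (W : Submodule ℝ E) : E →ₗ[ℝ] E :=
  if h : IsCompl W (g.orthogonal W) then W.projection (g.orthogonal W) h else 0

variable {k : ℕ}

/-- The geodesic factor `N₀ = c + {x ∈ V₀ | ⟨a_i, x⟩ > 0 for all i}`. -/
def geodesicFactor (g : LinearMap.BilinForm ℝ E) (V₀ : Submodule ℝ E) (a : Fin k → E) (c : E) :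
    Set E :=
  {p | p - c ∈ V₀ ∧ ∀ i, 0 < g (a i) (p - c)}

/-- The factors `N₀, N₁, …, N_k`. -/
noncomputable def factor (g : LinearMap.BilinForm ℝ E) (pbar : E)
    (V : Fin (k + 1) → Submodule ℝ E) (a : Fin k → E) (c : E) : Fin (k + 1) → Set E :=
  Fin.cons (geodesicFactor g (V 0) a c) (fun i => sphere g pbar (V i.succ) (a i))

/-- The warping functions `ρ_i(p₀) = ⟨a_i, p₀ - c⟩`. -/
def warping (g : LinearMap.BilinForm ℝ E) (a : Fin k → E) (c : E) (i : Fin k) (p₀ : E) : ℝ :=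
  g (a i) (p₀ - c)

/-- The warped product metric `π₀^* g + ∑ ρ_i² π_i^* g` on a product of submanifolds of `E`. -/
def warpedMetric (g : LinearMap.BilinForm ℝ E) (ρ : Fin k → E → ℝ)
    (p v w : Fin (k + 1) → E) : ℝ :=
  g (v 0) (w 0) + ∑ i : Fin k, (ρ i (p 0)) ^ 2 * g (v i.succ) (w i.succ)

/-- The map `ψ(p₀, …, p_k) = p₀ + ∑ ρ_i(p₀) (p_i - pbar)`. -/
def psi (g : LinearMap.BilinForm ℝ E) (pbar : E) (a : Fin k → E) (c : E)
    (p : Fin (k + 1) → E) : E :=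
  p 0 + ∑ i : Fin k, warping g a c i (p 0) • (p i.succ - pbar)

/-- The assertion that `ψ` is an isometry of the warped product `N₀ ×_{ρ₁} N₁ × ⋯ ×_{ρ_k} N_k`
onto the open set `T`, together with what makes this product a warped product of the
intended pseudo-Riemannian manifolds. -/
structure IsWarpedDecomposition (g : LinearMap.BilinForm ℝ E) (pbar : E)
    (V : Fin (k + 1) → Submodule ℝ E) (a : Fin k → E) (c : E) (T : Set E) : Prop where
  /-- every factor is a pseudo-Riemannian submanifold of dimension `dim V_j` -/
  pseudoRiemannian : ∀ j, IsPseudoRiemannianSubmanifold g (factor g pbar V a c j)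
    (Module.finrank ℝ (V j))
  /-- every factor passes through `pbar` with tangent space `V_j` -/
  mem : ∀ j, pbar ∈ factor g pbar V a c j
  tangent : ∀ j, tangentSpace (factor g pbar V a c j) pbar = V j
  /-- `N₀` is an open subset of the plane determined by `(pbar, V₀, 0)` -/
  geodesic_open : ∃ U : Set E, IsOpen U ∧ factor g pbar V a c 0 = sphere g pbar (V 0) 0 ∩ U
  /-- `N_i` is spherical with mean curvature vector `-a_i` at `pbar` -/
  spherical : ∀ i : Fin k, ∃ H : E → E,
    IsSphericalSubmanifold g (factor g pbar V a c i.succ) H ∧ H pbar = - a i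
  /-- the warping functions are positive on `N₀` and have the two stated forms -/
  warping_pos : ∀ i : Fin k, ∀ p₀ ∈ factor g pbar V a c 0,
    0 < warping g a c i p₀ ∧ warping g a c i p₀ = 1 + g (a i) (p₀ - pbar)
  isOpen : IsOpen T
  isometry : IsIsometryOnto (Set.univ.pi (factor g pbar V a c)) (warpedMetric g (warping g a c))
    T (fun _ v w => g v w) (psi g pbar a c)

/-- The subspace `W_i = ℝ a_i ⊕ V_i`. -/
def subspaceW (V : Fin (k + 1) → Submodule ℝ E) (a : Fin k → E) (i : Fin k) : Submodule ℝ E :=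
  (ℝ ∙ a i) ⊔ V i.succ

/-- The centre `c = pbar - ∑ a_i / a_i²` in the non-null case. -/
noncomputable def centre (g : LinearMap.BilinForm ℝ E) (pbar : E) (a : Fin k → E) : E :=
  pbar - ∑ i, (1 / g (a i) (a i)) • a i

/-- The set `c + {p | sgn (P_i p)² = sgn a_i² for all i}`, `P_i` the orthogonal projection
onto `W_i`. -/
noncomputable def nonNullImage (g : LinearMap.BilinForm ℝ E) (V : Fin (k + 1) → Submodule ℝ E)
    (a : Fin k → E) (c : E) : Set E :=
  {q | ∀ i, SignType.sign (g (orthProj g (subspaceW V a i) (q - c))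
      (orthProj g (subspaceW V a i) (q - c))) = SignType.sign (g (a i) (a i))}

/-- The set `c + {p | ⟨a_i, p⟩ > 0 for all i}` (used with a single `a`). -/
def nullImage (g : LinearMap.BilinForm ℝ E) (a : Fin k → E) (c : E) : Set E :=
  {q | ∀ i, 0 < g (a i) (q - c)}

/-- The form `g` is positive definite or negative definite on `W`: `W` is Euclidean or
anti-isometric to a Euclidean space. -/
def IsDefiniteOn (g : LinearMap.BilinForm ℝ E) (W : Submodule ℝ E) : Prop :=
  (∀ w ∈ W, w ≠ 0 → 0 < g w w) ∨ (∀ w ∈ W, w ≠ 0 → g w w < 0)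

end Objects

end WarpedPE

/-! Both cases rest on a single vector `b` in `V 0` with `⟨a_i, b⟩ = 1` for all `i` and `c = pbar -
b`: it is `∑ a_i / κ_i` when no `a_i` is null, and the chosen lightlike vector otherwise. With it
every spherical factor, central hyperquadric or paraboloid, is the quadric `2⟨b, x⟩ + x² = 0` for `x
= p - pbar` in `W_i = ℝ a_i ⊕ V_i` (`sphere_eq_quadric`), and almost nothing afterwards depends on
the causal character of `a_i`.

At `pbar + x` the quadric has tangent space `W_i ∩ ker ⟨b + x, ·⟩`, and `η = a_i + κ_i x` is a
transversal normal vector with `⟨b + x, η⟩ = 1`. Solving a quadratic equation along `η` presents the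
quadric as a graph, which gives embeddedness and tangent spaces (`QuadricData.isGraphNear`);
differentiating the equation twice shows that `-η` is the mean curvature vector field
(`QuadricData.isSphericalSubmanifold`).

For the metric, the differential of `ψ` sends `(v_j)` to `v_0 + ∑ (ρ_i v_i + ⟨a_i, v_0⟩ x_i)`. A
vector `v_0` of `V 0` pairs with `y` in `W_i` as `⟨a_i, v_0⟩ ⟨b, y⟩` (`base_apply`), and distinct
`W_i` are orthogonal. After expansion the unwanted terms are multiples of `⟨b + x_i, v_i⟩`, `⟨b +
x_i, w_i⟩` and `2⟨b, x_i⟩ + x_i²`, all zero, and `ρ_i² ⟨v_i, w_i⟩` remains (`metric_psi`).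

For bijectivity, put `z = ψ(p) - c`. The quadric equation gives `⟨a_i, z⟩² + κ_i (π_i z)² = ρ_i²`
(`psi_coords`). Thus `ρ_i`, and then every factor, is recovered smoothly from `z`, and the image is
where these expressions are positive, together with `⟨a_i, z⟩ > 0` if `κ_i = 0`. For `κ_i ≠ 0` the
left side is `κ_i (P_i z)²`, which yields the sign condition. Density then forces `κ_i w² ≥ 0` on
`W_i`, and a semidefinite non-degenerate form is definite; conversely, for definite `W_i` the image
is a finite intersection of complements of proper affine subspaces. -/

namespace WarpedPE

/-! ### Smooth curves in subsets and their velocities -/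

section Curves

variable {F : Type*} [NormedAddCommGroup F] [NormedSpace ℝ F]
variable {E : Type*} [NormedAddCommGroup E] [NormedSpace ℝ E]

theorem isSmoothOn_of_contDiffOn {f : F → E} {S U : Set F} (hU : IsOpen U) (hSU : S ⊆ U)
    (hf : ContDiffOn ℝ ∞ f U) : IsSmoothOn f S :=
  fun _ hx => ⟨U, hU, hSU hx, f, hf, fun _ _ => rfl⟩

namespace IsCurveIn

variable {S : Set F} {p : F} {γ : ℝ → F}

theorem contDiffAt (h : IsCurveIn S p γ) : ContDiffAt ℝ ∞ γ 0 := by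
  obtain ⟨-, ε, hε, hγ, -⟩ := h
  exact hγ.contDiffAt (Ioo_mem_nhds (by linarith) hε)

theorem eventually_mem (h : IsCurveIn S p γ) : ∀ᶠ t in 𝓝 0, γ t ∈ S := by
  obtain ⟨-, ε, hε, -, hS⟩ := h
  filter_upwards [Ioo_mem_nhds (show -ε < 0 by linarith) hε] using hS

theorem hasDerivAt (h : IsCurveIn S p γ) : HasDerivAt γ (deriv γ 0) 0 :=
  (h.contDiffAt.differentiableAt (by simp)).hasDerivAt

theorem eventually_hasDerivAt (h : IsCurveIn S p γ) :
    ∀ᶠ t in 𝓝 0, HasDerivAt γ (deriv γ t) t := by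
  obtain ⟨-, ε, hε, hγ, -⟩ := h
  filter_upwards [Ioo_mem_nhds (show -ε < 0 by linarith) hε] with t ht
  exact ((hγ.contDiffAt (isOpen_Ioo.mem_nhds ht)).differentiableAt (by simp)).hasDerivAt

theorem hasDerivAt_deriv (h : IsCurveIn S p γ) :
    HasDerivAt (deriv γ) (deriv (deriv γ) 0) 0 := by
  obtain ⟨-, ε, hε, hγ, -⟩ := h
  have h0 : (0 : ℝ) ∈ Set.Ioo (-ε) ε := ⟨by linarith, hε⟩
  have := hγ.deriv_of_isOpen (m := ∞) isOpen_Ioo (by simp)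
  exact ((this.contDiffAt (isOpen_Ioo.mem_nhds h0)).differentiableAt (by simp)).hasDerivAt

theorem deriv_mem_tangentSpace (h : IsCurveIn S p γ) : deriv γ 0 ∈ tangentSpace S p :=
  ⟨γ, h, rfl⟩

theorem eval {ι : Type*} [Fintype ι] {S : ι → Set F} {p : ι → F} {γ : ℝ → ι → F}
    (h : IsCurveIn (Set.univ.pi S) p γ) (j : ι) : IsCurveIn (S j) (p j) (fun t => γ t j) := by
  obtain ⟨h0, ε, hε, hγ, hS⟩ := h
  exact ⟨congrFun h0 j, ε, hε, contDiffOn_pi.1 hγ j, fun t ht => hS t ht j trivial⟩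

end IsCurveIn

end Curves

/-! ### Local graphs: tangent spaces and charts -/

section Graphs

variable {E : Type*} [NormedAddCommGroup E] [NormedSpace ℝ E]

/-- Near `p` the set `S` is the graph, over a neighbourhood of `0` in `L`, of a smooth map that
vanishes to first order at `0` and takes values in a complement of `L`. -/
def IsGraphNear (S : Set E) (p : E) (L : Submodule ℝ E) : Prop :=
  ∃ (U : Set E) (O : Set L) (f : L → E) (P : E →L[ℝ] L),
    IsOpen U ∧ p ∈ U ∧ IsOpen O ∧ 0 ∈ O ∧ ContDiffOn ℝ ∞ f O ∧ f 0 = 0 ∧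
    HasFDerivAt f (0 : L →L[ℝ] E) 0 ∧ (∀ v : L, P v = v) ∧ (∀ v ∈ O, P (f v) = 0) ∧
    (∀ v ∈ O, p + v + f v ∈ S ∩ U) ∧
    ∀ x ∈ S ∩ U, ∃ v ∈ O, x = p + v + f v

/-- A curve in the graph is determined by its projection to `L`, and the height `f` contributes
nothing to the velocity because its differential at `0` vanishes. Conversely, lifting the line `t •
w` to the graph realises any `w` in `L`. -/
theorem IsGraphNear.tangentSpace_eq {S : Set E} {p : E} {L : Submodule ℝ E}
    (h : IsGraphNear S p L) : tangentSpace S p = L := by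
  obtain ⟨U, O, f, P, hU, hpU, hO, h0, hf, hf0, hf', hP, hPf, hmem, hsurj⟩ := h
  ext v
  constructor
  · rintro ⟨γ, hγ, rfl⟩
    have hd := hγ.hasDerivAt
    have hev : ∀ᶠ t in 𝓝 0, γ t ∈ U :=
      hγ.contDiffAt.continuousAt.eventually_mem (hU.mem_nhds (by rwa [hγ.1]))
    have hPd : HasDerivAt (fun t => P (γ t - p)) (P (deriv γ 0)) 0 :=
      P.hasFDerivAt.comp_hasDerivAt 0 (hd.sub_const p)
    have hP0 : P (γ 0 - p) = 0 := by rw [hγ.1]; simp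
    have hfd : HasDerivAt (fun t => f (P (γ t - p))) 0 0 := by
      have := HasFDerivAt.comp_hasDerivAt (f := fun t => P (γ t - p)) 0
        (by rw [hP0]; exact hf') hPd
      simpa [Function.comp_def] using this
    have hsum : HasDerivAt (fun t => p + (P (γ t - p) : E) + f (P (γ t - p)))
        ((P (deriv γ 0) : E) + 0) 0 :=
      ((L.subtypeL.hasFDerivAt.comp_hasDerivAt 0 hPd).const_add p).add hfd
    have heq : γ =ᶠ[𝓝 0] fun t => p + (P (γ t - p) : E) + f (P (γ t - p)) := by
      filter_upwards [hγ.eventually_mem, hev] with t htS htU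
      obtain ⟨w, hw, hx⟩ := hsurj _ ⟨htS, htU⟩
      have : P (γ t - p) = w := by
        rw [hx, show p + (w : E) + f w - p = w + f w by abel, map_add, hP, hPf w hw, add_zero]
      rw [this, ← hx]
    have := (hsum.congr_of_eventuallyEq heq).deriv
    rw [this, add_zero]
    exact (P (deriv γ 0)).2
  · intro hv
    set w : L := ⟨v, hv⟩
    have hcont : Continuous fun t : ℝ => t • w := by fun_prop
    obtain ⟨ε, hε, hball⟩ := Metric.isOpen_iff.1 (hO.preimage hcont) 0 (by simpa using h0)
    have hsub : ∀ t ∈ Set.Ioo (-ε) ε, t • w ∈ O := fun t ht => hball (by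
      rw [Metric.mem_ball, Real.dist_eq, sub_zero]; exact abs_lt.2 ht)
    refine ⟨fun t => p + ((t • w : L) : E) + f (t • w), ⟨by simp [hf0], ε, hε, ?_, ?_⟩, ?_⟩
    · refine ContDiffOn.add ?_ ?_
      · have : ContDiff ℝ ∞ fun t : ℝ => p + t • v := by fun_prop
        exact this.contDiffOn
      · exact hf.comp (g := f) (by fun_prop : ContDiff ℝ ∞ fun t : ℝ => t • w).contDiffOn hsub
    · exact fun t ht => (hmem _ (hsub t ht)).1
    · have h1 : HasDerivAt (fun t : ℝ => t • w) w 0 := by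
        simpa using (hasDerivAt_id (0 : ℝ)).smul_const w
      have h2 : HasDerivAt (fun t : ℝ => f (t • w)) 0 0 := by
        have := HasFDerivAt.comp_hasDerivAt (f := fun t : ℝ => t • w) 0
          (by rw [zero_smul]; exact hf') h1
        simpa [Function.comp_def] using this
      have := ((L.subtypeL.hasFDerivAt.comp_hasDerivAt 0 h1).const_add p).add h2
      exact this.deriv.trans (add_zero _)

theorem isEmbeddedSubmanifold_of_isGraphNear [FiniteDimensional ℝ E] {S : Set E} {m : ℕ}
    {L : E → Submodule ℝ E} (hL : ∀ p ∈ S, Module.finrank ℝ (L p) = m)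
    (h : ∀ p ∈ S, IsGraphNear S p (L p)) : IsEmbeddedSubmanifold S m := by
  intro p hp
  obtain ⟨U, O, f, P, hU, hpU, hO, h0, hf, hf0, hf', hP, hPf, hmem, hsurj⟩ := h p hp
  let e : EuclideanSpace ℝ (Fin m) ≃L[ℝ] L p :=
    ContinuousLinearEquiv.ofFinrankEq (by simp [hL p hp])
  have hinv : ∀ v ∈ O, P (p + v + f v - p) = v := fun v hv => by
    rw [show p + (v : E) + f v - p = v + f v by abel, map_add, hP, hPf v hv, add_zero]
  have hleft : Set.LeftInvOn (fun x => e.symm (P (x - p)))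
      (fun z => p + (e z : E) + f (e z)) (e ⁻¹' O) := fun z hz => by
    simp only [hinv _ hz, ContinuousLinearEquiv.symm_apply_apply]
  refine ⟨U, hU, hpU, e ⁻¹' O, hO.preimage e.continuous, fun z => p + (e z : E) + f (e z),
    fun x => e.symm (P (x - p)), ?_, ?_, ⟨fun z hz => hmem _ hz, hleft.injOn, ?_⟩, hleft⟩
  · refine ContDiffOn.add ?_ (hf.comp (e.contDiff.contDiffOn) fun _ h => h)
    exact (contDiff_const.add ((L p).subtypeL.contDiff.comp e.contDiff)).contDiffOn
  · exact isSmoothOn_of_contDiffOn isOpen_univ (Set.subset_univ _)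
      (e.symm.contDiff.comp (P.contDiff.comp (contDiff_id.sub contDiff_const))).contDiffOn
  · intro x hx
    obtain ⟨v, hv, rfl⟩ := hsurj x hx
    exact ⟨e.symm v, by simpa using hv, by simp⟩

end Graphs

/-! ### Calculus of bilinear forms -/

section BilinearForms

variable {E : Type*} [NormedAddCommGroup E] [NormedSpace ℝ E] [FiniteDimensional ℝ E]
variable {F : Type*} [NormedAddCommGroup F] [NormedSpace ℝ F]

theorem exists_continuous_bilin (g : LinearMap.BilinForm ℝ E) :
    ∃ B : E →L[ℝ] E →L[ℝ] ℝ, ∀ x y, B x y = g x y :=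
  ⟨LinearMap.toContinuousLinearMap (LinearMap.toContinuousLinearMap.toLinearMap ∘ₗ g),
    fun _ _ => rfl⟩

theorem contDiffOn_bilin (g : LinearMap.BilinForm ℝ E) {f h : F → E} {S : Set F}
    (hf : ContDiffOn ℝ ∞ f S) (hh : ContDiffOn ℝ ∞ h S) :
    ContDiffOn ℝ ∞ (fun x => g (f x) (h x)) S := by
  obtain ⟨B, hB⟩ := exists_continuous_bilin g
  simp only [← hB]
  exact (B.contDiff.comp_contDiffOn hf).clm_apply hh

theorem contDiff_bilin (g : LinearMap.BilinForm ℝ E) {f h : F → E}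
    (hf : ContDiff ℝ ∞ f) (hh : ContDiff ℝ ∞ h) : ContDiff ℝ ∞ (fun x => g (f x) (h x)) :=
  contDiffOn_univ.1 (contDiffOn_bilin g hf.contDiffOn hh.contDiffOn)

theorem continuous_bilin (g : LinearMap.BilinForm ℝ E) {X : Type*} [TopologicalSpace X]
    {f h : X → E} (hf : Continuous f) (hh : Continuous h) :
    Continuous (fun x => g (f x) (h x)) := by
  obtain ⟨B, hB⟩ := exists_continuous_bilin g
  simp only [← hB]
  fun_prop

theorem hasDerivAt_bilin (g : LinearMap.BilinForm ℝ E) {γ δ : ℝ → E} {γ' δ' : E} {t : ℝ}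
    (hγ : HasDerivAt γ γ' t) (hδ : HasDerivAt δ δ' t) :
    HasDerivAt (fun s => g (γ s) (δ s)) (g γ' (δ t) + g (γ t) δ') t := by
  obtain ⟨B, hB⟩ := exists_continuous_bilin g
  simp only [← hB]
  exact (B.hasFDerivAt.comp_hasDerivAt t hγ).clm_apply hδ

/-- A projection with kernel `W` annihilates the curve near `t`, hence also its velocity. -/
theorem deriv_mem_submodule {W : Submodule ℝ E} {γ : ℝ → E} {γ' : E} {t : ℝ}
    (hγ : HasDerivAt γ γ' t) (h : ∀ᶠ s in 𝓝 t, γ s ∈ W) : γ' ∈ W := by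
  obtain ⟨φ, hφ⟩ := W.exists_isCompl
  let P : E →L[ℝ] E := LinearMap.toContinuousLinearMap (φ.projection W hφ.symm)
  have h1 : HasDerivAt (fun s => P (γ s)) (P γ') t := P.hasFDerivAt.comp_hasDerivAt t hγ
  have h2 : HasDerivAt (fun s => P (γ s)) 0 t :=
    (hasDerivAt_const t (0 : E)).congr_of_eventuallyEq (by
      filter_upwards [h] with s hs
      exact (Submodule.projection_apply_eq_zero_iff hφ.symm).2 hs)
  exact (Submodule.projection_apply_eq_zero_iff hφ.symm).1 (h1.unique h2)

end BilinearForms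

/-! ### Quadrics as spherical submanifolds -/

section Quadric

variable {E : Type*} [NormedAddCommGroup E] [NormedSpace ℝ E]

/-- The quadric `x² + 2 ⟨b, x⟩ = 0` in the plane `p + W`. -/
def quadric (g : LinearMap.BilinForm ℝ E) (p : E) (W : Submodule ℝ E) (b : E) : Set E :=
  {x | x - p ∈ W ∧ 2 * g b (x - p) + g (x - p) (x - p) = 0}

/-- The tangent space at `p + x` of the quadric determined by `(p, W, b)`. -/
def quadricTangent (g : LinearMap.BilinForm ℝ E) (W : Submodule ℝ E) (b x : E) :
    Submodule ℝ E :=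
  W ⊓ LinearMap.ker (g (b + x))

theorem mem_quadricTangent {g : LinearMap.BilinForm ℝ E} {W : Submodule ℝ E} {b x v : E} :
    v ∈ quadricTangent g W b x ↔ v ∈ W ∧ g b v + g x v = 0 := by
  simp [quadricTangent]

/-- The conditions on `(W, a, b)` under which the quadric of `(p, W, b)` is a spherical
submanifold with mean curvature vector `-a` at `p`. -/
structure QuadricData (g : LinearMap.BilinForm ℝ E) (W : Submodule ℝ E) (a b : E) : Prop where
  symm : ∀ x y, g x y = g y x
  mem : a ∈ W
  pairing : g b a = 1
  conj : ∀ y ∈ W, g a y = g a a * g b y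
  nondeg : ∀ v ∈ W, (∀ y ∈ W, g v y = 0) → g b v = 0 → v = 0

namespace QuadricData

variable {g : LinearMap.BilinForm ℝ E} {p : E} {W : Submodule ℝ E} {a b : E}

theorem normal_mem (h : QuadricData g W a b) {x : E} (hx : x ∈ W) : a + g a a • x ∈ W :=
  W.add_mem h.mem (W.smul_mem _ hx)

theorem normal_apply (h : QuadricData g W a b) (x : E) {v : E} (hv : v ∈ W) :
    g (a + g a a • x) v = g a a * (g b v + g x v) := by
  simp only [map_add, LinearMap.add_apply, map_smul, LinearMap.smul_apply, smul_eq_mul,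
    h.conj v hv]
  ring

theorem apply_normal (h : QuadricData g W a b) {x : E} (hx : x ∈ W)
    (hQ : 2 * g b x + g x x = 0) : g b (a + g a a • x) + g x (a + g a a • x) = 1 := by
  simp only [map_add, map_smul, smul_eq_mul, h.pairing, h.symm x a, h.conj x hx]
  linear_combination g a a * hQ

/-- Since `⟨b + x, η⟩ = 1` for `η = a + a² x`, subtracting `⟨b + x, y⟩ η` is the projection of `W`
along `η` onto the tangent space. -/
theorem sub_normal_mem (h : QuadricData g W a b) {x : E} (hx : x ∈ W)
    (hQ : 2 * g b x + g x x = 0) {y : E} (hy : y ∈ W) :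
    y - (g b y + g x y) • (a + g a a • x) ∈ quadricTangent g W b x := by
  refine mem_quadricTangent.2 ⟨W.sub_mem hy (W.smul_mem _ (h.normal_mem hx)), ?_⟩
  have := h.apply_normal hx hQ
  simp only [map_sub, map_smul, smul_eq_mul]
  linear_combination -(g b y + g x y) * this

theorem normal_tangent (h : QuadricData g W a b) {x v : E}
    (hv : v ∈ quadricTangent g W b x) : g (a + g a a • x) v = 0 := by
  obtain ⟨hvW, hv⟩ := mem_quadricTangent.1 hv
  rw [h.normal_apply x hvW, hv, mul_zero]

theorem tangent_nondegenerate (h : QuadricData g W a b) {x : E} (hx : x ∈ W)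
    (hQ : 2 * g b x + g x x = 0) {v : E} (hv : v ∈ quadricTangent g W b x)
    (h0 : ∀ w ∈ quadricTangent g W b x, g v w = 0) : v = 0 := by
  obtain ⟨hvW, hv'⟩ := mem_quadricTangent.1 hv
  -- Modulo `η` every `y` in `W` is tangent, and `η` is orthogonal to `v`. `W` itself may be
  -- degenerate (null case), so the condition on `b` is still needed to conclude.
  have key : ∀ y ∈ W, g v y = 0 := fun y hy => by
    have h1 := h0 _ (h.sub_normal_mem hx hQ hy)
    rw [map_sub, map_smul, h.symm v (a + _), h.normal_tangent hv, smul_zero, sub_zero] at h1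
    exact h1
  refine h.nondeg v hvW key ?_
  rw [h.symm x v, key x hx, add_zero] at hv'
  exact hv'

theorem finrank_tangent [FiniteDimensional ℝ E] (h : QuadricData g W a b) {x : E} (hx : x ∈ W)
    (hQ : 2 * g b x + g x x = 0) :
    Module.finrank ℝ (quadricTangent g W b x) + 1 = Module.finrank ℝ W := by
  set η := a + g a a • x
  have hη := h.apply_normal hx hQ
  have hη0 : η ≠ 0 := fun h0 => by
    change g b η + g x η = 1 at hη
    rw [h0] at hη; simp at hη
  have hsup : quadricTangent g W b x ⊔ (ℝ ∙ η) = W := by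
    refine le_antisymm (sup_le inf_le_left ?_) fun y hy => ?_
    · rw [Submodule.span_singleton_le_iff_mem]; exact h.normal_mem hx
    · refine Submodule.mem_sup.2 ⟨_, h.sub_normal_mem hx hQ hy, (g b y + g x y) • η,
        Submodule.smul_mem _ _ (Submodule.mem_span_singleton_self η), by simp [η]⟩
  have hinf : quadricTangent g W b x ⊓ (ℝ ∙ η) = ⊥ := by
    rw [eq_bot_iff]
    rintro y ⟨hy, hy'⟩
    obtain ⟨t, rfl⟩ := Submodule.mem_span_singleton.1 hy'
    have := (mem_quadricTangent.1 hy).2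
    rw [map_smul, map_smul, ← smul_add, hη, smul_eq_mul, mul_one] at this
    simp [this]
  have := Submodule.finrank_sup_add_finrank_inf_eq (quadricTangent g W b x) (ℝ ∙ η)
  rw [hsup, hinf, finrank_bot, finrank_span_singleton hη0] at this
  omega

/-- The solution `τ` of `κ τ² + 2 τ + G = 0` that vanishes for `G = 0`. -/
noncomputable def height (κ G : ℝ) : ℝ := -G / (1 + Real.sqrt (1 - κ * G))

theorem height_zero (κ : ℝ) : height κ 0 = 0 := by simp [height]

theorem contDiffOn_height (κ : ℝ) : ContDiffOn ℝ ∞ (height κ) {G | κ * G < 1} := by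
  refine ContDiffOn.div (by fun_prop) ?_ fun G _ => by positivity
  refine contDiffOn_const.add (ContDiffOn.sqrt (by fun_prop) fun G hG => ?_)
  have : κ * G < 1 := hG
  linarith

/-- The root is kept in rationalised form so that `κ = 0` is covered; `1 + κ τ > 0` is what
distinguishes it from the other root. -/
theorem one_add_mul_height {κ G : ℝ} (hG : κ * G < 1) :
    1 + κ * height κ G = Real.sqrt (1 - κ * G) := by
  have h1 := Real.sq_sqrt (show 0 ≤ 1 - κ * G by linarith)
  have h2 : 0 < 1 + Real.sqrt (1 - κ * G) := by positivity
  rw [height]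
  field_simp
  nlinarith

theorem height_spec {κ G : ℝ} (hG : κ * G < 1) :
    κ * height κ G ^ 2 + 2 * height κ G + G = 0 := by
  have h2 : 0 < 1 + Real.sqrt (1 - κ * G) := by positivity
  have h3 : height κ G * (1 + Real.sqrt (1 - κ * G)) = -G := by
    rw [height]; field_simp
  rw [← one_add_mul_height hG] at h3
  linear_combination h3

theorem height_unique {κ G τ : ℝ} (h : κ * τ ^ 2 + 2 * τ + G = 0) (hτ : 0 < 1 + κ * τ) :
    κ * G < 1 ∧ height κ G = τ := by
  have h1 : 1 - κ * G = (1 + κ * τ) ^ 2 := by linear_combination -κ * h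
  refine ⟨by nlinarith [pow_pos hτ 2], ?_⟩
  rw [height, h1, Real.sqrt_sq hτ.le, div_eq_iff (by linarith)]
  linear_combination -h

/-- The cross terms disappear because `⟨b + x, l⟩ = 0` and `⟨η, l⟩ = 0`, while `⟨b + x, η⟩ = 1` and
`⟨η, η⟩ = a²`. What is left is the quadratic equation solved by `height`. -/
theorem quadric_eq_zero_iff (h : QuadricData g W a b) {x l : E} (hx : x ∈ W)
    (hQ : 2 * g b x + g x x = 0) (hl : l ∈ quadricTangent g W b x) (τ : ℝ) :
    2 * g b (x + l + τ • (a + g a a • x)) +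
      g (x + l + τ • (a + g a a • x)) (x + l + τ • (a + g a a • x)) =
    g a a * τ ^ 2 + 2 * τ + g l l := by
  have h1 := h.apply_normal hx hQ
  have h2 := (mem_quadricTangent.1 hl).2
  have h3 := h.normal_tangent hl
  have h4 := h.normal_apply x (h.normal_mem hx)
  rw [h1] at h4
  generalize a + g a a • x = η at *
  simp only [map_add, map_smul, LinearMap.add_apply, LinearMap.smul_apply, smul_eq_mul]
  rw [h.symm l x, h.symm η x, h.symm l η]
  linear_combination hQ + 2 * h2 + 2 * τ * h1 + 2 * τ * h3 + τ ^ 2 * h4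

theorem isGraphNear [FiniteDimensional ℝ E] (h : QuadricData g W a b) {q : E}
    (hq : q ∈ quadric g p W b) :
    IsGraphNear (quadric g p W b) q (quadricTangent g W b (q - p)) := by
  obtain ⟨hx, hQ⟩ := hq
  set x := q - p with hxdef
  set L := quadricTangent g W b x
  set η := a + g a a • x with hη
  have hηW : η ∈ W := h.normal_mem hx
  have hη1 : g b η + g x η = 1 := h.apply_normal hx hQ
  obtain ⟨R, hR⟩ := W.subtype.exists_leftInverse_of_injective W.ker_subtype
  have hR' : ∀ y (hy : y ∈ W), (R y : E) = y := fun y hy => by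
    have := LinearMap.congr_fun hR ⟨y, hy⟩
    exact congrArg Subtype.val this
  -- `W` may be degenerate, so an arbitrary linear retraction `R` onto `W` replaces the orthogonal
  -- projection; it is followed by the projection along `η`.
  let P₀ : E →ₗ[ℝ] L := LinearMap.codRestrict L
    (W.subtype ∘ₗ R - ((g b + g x) ∘ₗ W.subtype ∘ₗ R).smulRight η)
    fun y => h.sub_normal_mem hx hQ (R y).2
  have hP₀ : ∀ y ∈ W, (P₀ y : E) = y - (g b y + g x y) • η := fun y hy => by
    have : (P₀ y : E) = (R y : E) - (g b (R y) + g x (R y)) • η := rfl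
    rw [this, hR' y hy]
  let P : E →L[ℝ] L := LinearMap.toContinuousLinearMap P₀
  have hlin : ∀ c : E, Continuous fun y => g c y := fun c =>
    continuous_bilin g continuous_const continuous_id
  have hG : ContDiff ℝ ∞ fun l : L => g (l : E) (l : E) :=
    contDiff_bilin g L.subtypeL.contDiff L.subtypeL.contDiff
  have hO : IsOpen {l : L | g a a * g (l : E) (l : E) < 1} :=
    isOpen_lt (continuous_const.mul hG.continuous) continuous_const
  have hτ : ContDiffOn ℝ ∞ (fun l : L => height (g a a) (g (l : E) (l : E)))
      {l : L | g a a * g (l : E) (l : E) < 1} :=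
    (contDiffOn_height _).comp hG.contDiffOn fun _ h => h
  have h0O : (0 : L) ∈ {l : L | g a a * g (l : E) (l : E) < 1} := by simp
  -- At `y = q + l + τ η` the functional `⟨b + x, y - q⟩` equals `τ`, so this open half-space is the
  -- condition `1 + a² τ > 0` that selects the root `height`.
  refine ⟨{y | 0 < 1 + g a a * (g b (y - q) + g x (y - q))},
    {l | g a a * g (l : E) (l : E) < 1},
    fun l => height (g a a) (g (l : E) (l : E)) • η, P, ?_, ?_, hO, h0O, ?_, ?_, ?_, ?_, ?_, ?_, ?_⟩
  · refine isOpen_lt continuous_const (continuous_const.add (continuous_const.mul ?_))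
    exact ((hlin b).comp (continuous_id.sub continuous_const)).add
      ((hlin x).comp (continuous_id.sub continuous_const))
  · simp
  · exact hτ.smul contDiffOn_const
  · simp [height_zero]
  · have hd : HasFDerivAt (fun l : L => g (l : E) (l : E)) (0 : L →L[ℝ] ℝ) 0 := by
      obtain ⟨B, hB⟩ := exists_continuous_bilin g
      have h1 := L.subtypeL.hasFDerivAt (x := 0)
      have h2 := (B.hasFDerivAt.comp (0 : L) h1).clm_apply h1
      simp only [← hB]
      refine h2.congr_fderiv ?_
      ext l; simp
    have hh : HasDerivAt (height (g a a)) (deriv (height (g a a)) 0) (g ((0 : L) : E) (0 : L)) := by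
      have hz : g ((0 : L) : E) (0 : L) = 0 := by simp
      rw [hz]
      refine (((contDiffOn_height (g a a)).contDiffAt ?_).differentiableAt (by simp)).hasDerivAt
      exact (isOpen_lt (by fun_prop) continuous_const).mem_nhds (by simp)
    have := (hh.comp_hasFDerivAt (0 : L) hd).smul_const η
    refine this.congr_fderiv ?_
    ext l; simp
  · intro l
    apply Subtype.ext
    obtain ⟨hl1, hl2⟩ := mem_quadricTangent.1 l.2
    change (P₀ l : E) = l
    rw [hP₀ _ hl1, hl2, zero_smul, sub_zero]
  · intro l _
    apply Subtype.ext
    change (P₀ (_ • η) : E) = 0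
    rw [hP₀ _ (W.smul_mem _ hηW), map_smul, map_smul, ← smul_add, hη1, smul_eq_mul, mul_one,
      sub_self]
  · intro l hl
    have hl' : g a a * g (l : E) (l : E) < 1 := hl
    have e1 : q + (l : E) + height (g a a) (g (l : E) (l : E)) • η - p =
        x + l + height (g a a) (g (l : E) (l : E)) • η := by rw [hxdef]; abel
    have e2 : q + (l : E) + height (g a a) (g (l : E) (l : E)) • η - q =
        l + height (g a a) (g (l : E) (l : E)) • η := by abel
    obtain ⟨hl1, hl2⟩ := mem_quadricTangent.1 l.2
    refine ⟨⟨?_, ?_⟩, ?_⟩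
    · rw [e1]
      exact W.add_mem (W.add_mem hx hl1) (W.smul_mem _ hηW)
    · rw [e1, h.quadric_eq_zero_iff hx hQ l.2, height_spec hl']
    · change 0 < 1 + g a a * _
      rw [e2]
      have : g b ((l : E) + height (g a a) (g (l : E) (l : E)) • η) +
          g x ((l : E) + height (g a a) (g (l : E) (l : E)) • η) =
          height (g a a) (g (l : E) (l : E)) := by
        simp only [map_add, map_smul, smul_eq_mul]
        linear_combination hl2 + height (g a a) (g (l : E) (l : E)) * hη1
      rw [this, one_add_mul_height hl']
      exact Real.sqrt_pos.2 (by linarith)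
  · rintro y ⟨⟨hyW, hyQ⟩, hyU⟩
    have hyq : y - q ∈ W := by
      have := W.sub_mem hyW hx
      rwa [hxdef, sub_sub_sub_cancel_right] at this
    set τ := g b (y - q) + g x (y - q)
    have hl := h.sub_normal_mem hx hQ hyq
    set l := y - q - τ • η with hldef
    have e1 : y - p = x + l + τ • η := by rw [hldef, hxdef]; abel
    rw [e1, h.quadric_eq_zero_iff hx hQ hl] at hyQ
    obtain ⟨hl1, hl2⟩ := height_unique hyQ hyU
    refine ⟨⟨l, hl⟩, hl1, ?_⟩
    simp only [hl2]
    rw [hldef]; abel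

theorem tangentSpace_eq [FiniteDimensional ℝ E] (h : QuadricData g W a b) {q : E}
    (hq : q ∈ quadric g p W b) :
    tangentSpace (quadric g p W b) q = quadricTangent g W b (q - p) :=
  (h.isGraphNear hq).tangentSpace_eq

theorem isPseudoRiemannianSubmanifold [FiniteDimensional ℝ E] (h : QuadricData g W a b) {m : ℕ}
    (hm : Module.finrank ℝ W = m + 1) :
    IsPseudoRiemannianSubmanifold g (quadric g p W b) m where
  embedded := isEmbeddedSubmanifold_of_isGraphNear
    (fun q hq => by have := h.finrank_tangent hq.1 hq.2; omega) fun q hq => h.isGraphNear hq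
  nondegenerate q hq v hv h0 := by
    rw [h.tangentSpace_eq hq] at hv h0
    exact h.tangent_nondegenerate hq.1 hq.2 hv h0

/-- Differentiating the equation of the quadric twice gives `⟨b + x, γ''⟩ + ⟨γ', γ'⟩ = 0`. As `⟨b +
x, η⟩ = 1`, the vector `γ'' + ⟨γ', γ'⟩ η` is tangent, so `H = -η`. Along a curve `H' = -a² γ'` is
tangent, so `H` is parallel. -/
theorem isSphericalSubmanifold [FiniteDimensional ℝ E] (h : QuadricData g W a b) :
    IsSphericalSubmanifold g (quadric g p W b) fun x => -(a + g a a • (x - p)) where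
  smooth := isSmoothOn_of_contDiffOn isOpen_univ (Set.subset_univ _) (by fun_prop)
  normal q hq v hv := by
    rw [h.tangentSpace_eq hq] at hv
    rw [map_neg, LinearMap.neg_apply, h.normal_tangent hv, neg_zero]
  umbilical q hq γ hγ := by
    rw [h.tangentSpace_eq hq]
    have hd := hγ.hasDerivAt
    have hdd := hγ.hasDerivAt_deriv
    have hmem : ∀ᶠ t in 𝓝 0, deriv γ t ∈ W ∧
        2 * g b (deriv γ t) + (g (deriv γ t) (γ t - p) + g (γ t - p) (deriv γ t)) = 0 := by
      filter_upwards [hγ.eventually_mem.eventually_nhds, hγ.eventually_hasDerivAt] with t ht hdt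
      refine ⟨?_, ?_⟩
      · exact deriv_mem_submodule (hdt.sub_const p) (ht.mono fun s hs => hs.1)
      · have h1 := ((hasDerivAt_bilin g (hasDerivAt_const t b) (hdt.sub_const p)).const_mul 2).add
          (hasDerivAt_bilin g (hdt.sub_const p) (hdt.sub_const p))
        have h2 := h1.unique ((hasDerivAt_const t (0 : ℝ)).congr_of_eventuallyEq
          (ht.mono fun s hs => hs.2))
        simpa using h2
    have hW : deriv (deriv γ) 0 ∈ W := deriv_mem_submodule hdd (hmem.mono fun s hs => hs.1)
    have h1 := ((hasDerivAt_bilin g (hasDerivAt_const (0 : ℝ) b) hdd).const_mul 2).add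
      ((hasDerivAt_bilin g hdd (hd.sub_const p)).add (hasDerivAt_bilin g (hd.sub_const p) hdd))
    have h2 := h1.unique ((hasDerivAt_const (0 : ℝ) (0 : ℝ)).congr_of_eventuallyEq
      (hmem.mono fun s hs => hs.2))
    rw [hγ.1, h.symm _ (q - p)] at h2
    simp only [map_zero, LinearMap.zero_apply, zero_add] at h2
    rw [smul_neg, sub_neg_eq_add]
    refine mem_quadricTangent.2 ⟨W.add_mem hW (W.smul_mem _ (h.normal_mem hq.1)), ?_⟩
    have h3 := h.apply_normal hq.1 hq.2
    rw [map_add, map_add, map_smul, map_smul, smul_eq_mul, smul_eq_mul]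
    linear_combination h2 / 2 + g (deriv γ 0) (deriv γ 0) * h3
  parallel q hq γ hγ := by
    have hd : HasDerivAt ((fun x => -(a + g a a • (x - p))) ∘ γ) (-(g a a • deriv γ 0)) 0 :=
      (((hγ.hasDerivAt.sub_const p).const_smul (g a a)).const_add a).neg
    have := hγ.deriv_mem_tangentSpace
    rw [h.tangentSpace_eq hq] at this ⊢
    rw [hd.deriv]
    exact Submodule.neg_mem _ (Submodule.smul_mem _ _ this)

end QuadricData

end Quadric

/-! ### The factors of the warped product -/

section WarpedProduct

variable {E : Type*} [NormedAddCommGroup E] [NormedSpace ℝ E]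
variable {k : ℕ}

/-- An orthogonal decomposition `E = V₀ ⊕ ⋯ ⊕ V_k` into non-degenerate subspaces with orthogonal
projections `π_j`, orthogonal vectors `a_i ∈ V₀`, and `b ∈ V₀` with `⟨a_i, b⟩ = 1` for all `i`. -/
structure WarpedData (g : LinearMap.BilinForm ℝ E) (V : Fin (k + 1) → Submodule ℝ E)
    (a : Fin k → E) (b : E) (π : Fin (k + 1) → E →ₗ[ℝ] E) : Prop where
  symm : ∀ x y, g x y = g y x
  orth : ∀ i j, i ≠ j → ∀ x ∈ V i, ∀ y ∈ V j, g x y = 0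
  nondeg : ∀ j, ∀ x ∈ V j, (∀ y ∈ V j, g x y = 0) → x = 0
  mem : ∀ i, a i ∈ V 0
  orth_vec : ∀ i j, i ≠ j → g (a i) (a j) = 0
  base_mem : b ∈ V 0
  pairing : ∀ i, g (a i) b = 1
  proj_mem : ∀ j x, π j x ∈ V j
  proj_sum : ∀ x, ∑ j, π j x = x

/-- The square of the warping function `ρ_i` in terms of the value of `ψ - c`. -/
def warpingSq (g : LinearMap.BilinForm ℝ E) (a : Fin k → E) (π : Fin (k + 1) → E →ₗ[ℝ] E)
    (i : Fin k) (x : E) : ℝ :=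
  g (a i) x ^ 2 + g (a i) (a i) * g (π i.succ x) (π i.succ x)

/-- The image of `ψ`, described uniformly in the null and the non-null case. -/
def warpedImage (g : LinearMap.BilinForm ℝ E) (a : Fin k → E) (π : Fin (k + 1) → E →ₗ[ℝ] E)
    (c : E) : Set E :=
  {q | ∀ i, 0 < warpingSq g a π i (q - c) ∧ (g (a i) (a i) = 0 → 0 < g (a i) (q - c))}

/-- The component along `a_i` of the `i`-th component of `ψ⁻¹`. -/
noncomputable def inverseCoord (g : LinearMap.BilinForm ℝ E) (a : Fin k → E)
    (π : Fin (k + 1) → E →ₗ[ℝ] E) (i : Fin k) (x : E) : ℝ :=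
  if g (a i) (a i) = 0 then -(1 / 2) * g (π i.succ x) (π i.succ x) / warpingSq g a π i x
  else (g (a i) x / Real.sqrt (warpingSq g a π i x) - 1) / g (a i) (a i)

/-- The `i`-th component of `ψ⁻¹`, relative to the base point. -/
noncomputable def inverseFiber (g : LinearMap.BilinForm ℝ E) (a : Fin k → E)
    (π : Fin (k + 1) → E →ₗ[ℝ] E) (i : Fin k) (x : E) : E :=
  inverseCoord g a π i x • a i + (Real.sqrt (warpingSq g a π i x))⁻¹ • π i.succ x

/-- The inverse of `ψ`. -/
noncomputable def psiInv (g : LinearMap.BilinForm ℝ E) (pbar : E) (a : Fin k → E)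
    (π : Fin (k + 1) → E →ₗ[ℝ] E) (c : E) (q : E) : Fin (k + 1) → E :=
  Fin.cons (q - ∑ i, Real.sqrt (warpingSq g a π i (q - c)) • inverseFiber g a π i (q - c))
    (fun i => pbar + inverseFiber g a π i (q - c))

theorem mem_subspaceW {V : Fin (k + 1) → Submodule ℝ E} {a : Fin k → E} {i : Fin k} {y : E} :
    y ∈ subspaceW V a i ↔ ∃ s : ℝ, ∃ u ∈ V i.succ, y = s • a i + u := by
  rw [subspaceW, Submodule.mem_sup]
  constructor
  · rintro ⟨z, hz, u, hu, rfl⟩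
    obtain ⟨s, rfl⟩ := Submodule.mem_span_singleton.1 hz
    exact ⟨s, u, hu, rfl⟩
  · rintro ⟨s, u, hu, rfl⟩
    exact ⟨_, Submodule.smul_mem _ s (Submodule.mem_span_singleton_self _), u, hu, rfl⟩

namespace WarpedData

variable {g : LinearMap.BilinForm ℝ E} {V : Fin (k + 1) → Submodule ℝ E}
  {a : Fin k → E} {b : E} {π : Fin (k + 1) → E →ₗ[ℝ] E}

theorem apply_fiber (h : WarpedData g V a b π) {i : Fin k} {v u : E} (hv : v ∈ V 0)
    (hu : u ∈ V i.succ) : g v u = 0 :=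
  h.orth 0 i.succ (Fin.succ_ne_zero i).symm v hv u hu

theorem proj_apply (h : WarpedData g V a b π) (j : Fin (k + 1)) (x : E) {z : E} (hz : z ∈ V j) :
    g (π j x) z = g x z := by
  conv_rhs => rw [← h.proj_sum x]
  rw [map_sum, LinearMap.sum_apply, Finset.sum_eq_single j]
  · exact fun l _ hl => h.orth l j hl _ (h.proj_mem l x) z hz
  · simp

theorem proj_eq_of_forall (h : WarpedData g V a b π) {j : Fin (k + 1)} {x y : E} (hy : y ∈ V j)
    (hxy : ∀ z ∈ V j, g x z = g y z) : π j x = y := by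
  refine sub_eq_zero.1 (h.nondeg j _ ((V j).sub_mem (h.proj_mem j x) hy) fun z hz => ?_)
  rw [map_sub, LinearMap.sub_apply, h.proj_apply j x hz, hxy z hz, sub_self]

theorem proj_self (h : WarpedData g V a b π) {j : Fin (k + 1)} {x : E} (hx : x ∈ V j) :
    π j x = x :=
  h.proj_eq_of_forall hx fun _ _ => rfl

theorem proj_of_ne (h : WarpedData g V a b π) {i j : Fin (k + 1)} (hij : i ≠ j) {x : E}
    (hx : x ∈ V i) : π j x = 0 :=
  h.proj_eq_of_forall (V j).zero_mem fun z hz => by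
    rw [h.orth i j hij x hx z hz, map_zero, LinearMap.zero_apply]

/-- Only the `a_i`-component of `y` pairs with `V 0`, and its coefficient is `⟨b, y⟩` because `⟨a_i,
b⟩ = 1`. -/
theorem base_apply (h : WarpedData g V a b π) {i : Fin k} {y : E}
    (hy : y ∈ subspaceW V a i) {w : E} (hw : w ∈ V 0) : g w y = g (a i) w * g b y := by
  obtain ⟨s, u, hu, rfl⟩ := mem_subspaceW.1 hy
  rw [map_add, map_add, h.apply_fiber hw hu, h.apply_fiber h.base_mem hu, map_smul, map_smul,
    h.symm b, h.pairing, h.symm w]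
  simp [mul_comm]

theorem orth_subspaceW (h : WarpedData g V a b π) {i j : Fin k} (hij : i ≠ j) {x y : E}
    (hx : x ∈ subspaceW V a i) (hy : y ∈ subspaceW V a j) : g x y = 0 := by
  obtain ⟨s, u, hu, rfl⟩ := mem_subspaceW.1 hx
  obtain ⟨t, w, hw, rfl⟩ := mem_subspaceW.1 hy
  simp only [map_add, map_smul, LinearMap.add_apply, LinearMap.smul_apply, h.symm u (a j),
    h.apply_fiber (h.mem _) hu, h.apply_fiber (h.mem _) hw, h.orth_vec i j hij,
    h.orth i.succ j.succ (by simpa using hij) u hu w hw]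
  simp

theorem quadricData (h : WarpedData g V a b π) (i : Fin k) :
    QuadricData g (subspaceW V a i) (a i) b where
  symm := h.symm
  mem := Submodule.mem_sup_left (Submodule.mem_span_singleton_self _)
  pairing := by rw [h.symm]; exact h.pairing i
  conj y hy := h.base_apply hy (h.mem i)
  nondeg v hv h0 hb := by
    obtain ⟨s, u, hu, rfl⟩ := mem_subspaceW.1 hv
    have hs : s = 0 := by
      simpa [h.apply_fiber h.base_mem hu, h.symm b (a i), h.pairing i] using hb
    subst hs
    rw [zero_smul, zero_add] at h0 ⊢
    exact h.nondeg _ u hu fun y hy => h0 y (Submodule.mem_sup_right hy)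

theorem finrank_subspaceW [FiniteDimensional ℝ E] (h : WarpedData g V a b π) (i : Fin k) :
    Module.finrank ℝ (subspaceW V a i) = Module.finrank ℝ (V i.succ) + 1 := by
  have ha : a i ≠ 0 := fun h0 => by
    have := h.pairing i; rw [h0] at this; simp at this
  have hinf : (ℝ ∙ a i) ⊓ V i.succ = ⊥ := by
    rw [eq_bot_iff]
    rintro y ⟨hy, hy'⟩
    obtain ⟨t, rfl⟩ := Submodule.mem_span_singleton.1 hy
    have := h.apply_fiber h.base_mem hy'
    rw [map_smul, h.symm, h.pairing, smul_eq_mul, mul_one] at this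
    simp [this]
  have := Submodule.finrank_sup_add_finrank_inf_eq (ℝ ∙ a i) (V i.succ)
  rw [hinf, finrank_bot, finrank_span_singleton ha] at this
  rw [subspaceW]
  omega

theorem mem_quadric (h : WarpedData g V a b π) {p x : E} {i : Fin k} :
    x ∈ quadric g p (subspaceW V a i) b ↔ ∃ s : ℝ, ∃ u ∈ V i.succ, x - p = s • a i + u ∧
      2 * s + g (a i) (a i) * s ^ 2 + g u u = 0 := by
  have key : ∀ s : ℝ, ∀ u ∈ V i.succ, 2 * g b (s • a i + u) + g (s • a i + u) (s • a i + u) =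
      2 * s + g (a i) (a i) * s ^ 2 + g u u := fun s u hu => by
    simp only [map_add, map_smul, LinearMap.add_apply, LinearMap.smul_apply, smul_eq_mul,
      h.symm u (a i), h.apply_fiber (h.mem i) hu, h.apply_fiber h.base_mem hu, h.symm b (a i),
      h.pairing i]
    ring
  constructor
  · rintro ⟨hx, hQ⟩
    obtain ⟨s, u, hu, hsu⟩ := mem_subspaceW.1 hx
    refine ⟨s, u, hu, hsu, ?_⟩
    rw [← key s u hu, ← hsu, hQ]
  · rintro ⟨s, u, hu, hsu, hQ⟩
    refine ⟨mem_subspaceW.2 ⟨s, u, hu, hsu⟩, ?_⟩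
    rw [hsu, key s u hu, hQ]

/-- On `W_i` the functional `⟨b, ·⟩` reads off the coefficient `s` of `a_i`. If `a_i` is null the
equation is linear in `s` and describes the paraboloid; otherwise completing the square moves the
origin to the centre, `s + 1 / a_i²` being the new coordinate. -/
theorem sphere_eq_quadric (h : WarpedData g V a b π) (p : E) (i : Fin k) :
    sphere g p (V i.succ) (a i) = quadric g p (subspaceW V a i) b := by
  have ha : a i ≠ 0 := fun h0 => by
    have := h.pairing i; rw [h0] at this; simp at this
  ext x
  rw [sphere, if_neg ha, h.mem_quadric]
  split_ifs with hκ
  · rw [hκ]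
    constructor
    · rintro ⟨v, hv, rfl⟩
      exact ⟨-((1 / 2 : ℝ) * g v v), v, hv, by rw [neg_smul]; abel, by ring⟩
    · rintro ⟨s, u, hu, hsu, hQ⟩
      refine ⟨u, hu, ?_⟩
      rw [show (1 / 2 : ℝ) * g u u = -s by linarith, neg_smul, sub_neg_eq_add, add_comm u, ← hsu]
      abel
  · have key : ∀ t : ℝ, ∀ u ∈ V i.succ, g (t • a i + u) (t • a i + u) =
        t ^ 2 * g (a i) (a i) + g u u := fun t u hu => by
      simp only [map_add, map_smul, LinearMap.add_apply, LinearMap.smul_apply, smul_eq_mul,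
        h.symm u (a i), h.apply_fiber (h.mem i) hu]
      ring
    constructor
    · rintro ⟨w, hw, hww, rfl⟩
      obtain ⟨t, u, hu, rfl⟩ := mem_subspaceW.1 hw
      refine ⟨t - 1 / g (a i) (a i), u, hu, by rw [sub_smul]; abel, ?_⟩
      rw [key t u hu] at hww
      field_simp at hww ⊢
      linear_combination hww
    · rintro ⟨s, u, hu, hsu, hQ⟩
      refine ⟨(s + 1 / g (a i) (a i)) • a i + u, mem_subspaceW.2 ⟨_, u, hu, rfl⟩, ?_, ?_⟩
      · rw [key _ u hu]
        field_simp
        linear_combination g (a i) (a i) * hQ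
      · rw [sub_eq_iff_eq_add'.1 hsu, add_smul]; abel

theorem factor_zero (g : LinearMap.BilinForm ℝ E) (pbar : E)
    (V : Fin (k + 1) → Submodule ℝ E) (a : Fin k → E) (c : E) :
    factor g pbar V a c 0 = geodesicFactor g (V 0) a c := rfl

theorem factor_succ (h : WarpedData g V a b π) (pbar c : E) (i : Fin k) :
    factor g pbar V a c i.succ = quadric g pbar (subspaceW V a i) b :=
  h.sphere_eq_quadric pbar i

theorem base_mem_quadric (pbar : E) (W : Submodule ℝ E) : pbar ∈ quadric g pbar W b := by
  simp [quadric]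

theorem isGraphNear_geodesicFactor [FiniteDimensional ℝ E] (g : LinearMap.BilinForm ℝ E)
    {W : Submodule ℝ E} {c p : E} (hp : p ∈ geodesicFactor g W a c) :
    IsGraphNear (geodesicFactor g W a c) p W := by
  obtain ⟨R, hR⟩ := W.subtype.exists_leftInverse_of_injective W.ker_subtype
  have hc : ∀ i, Continuous fun x => g (a i) (x - c) := fun i =>
    continuous_bilin g continuous_const (continuous_id.sub continuous_const)
  have hU : IsOpen {x | ∀ i, 0 < g (a i) (x - c)} := by
    rw [Set.ofPred_forall]
    exact isOpen_iInter_of_finite fun i => isOpen_lt continuous_const (hc i)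
  refine ⟨{x | ∀ i, 0 < g (a i) (x - c)}, (fun v : W => p + v) ⁻¹' {x | ∀ i, 0 < g (a i) (x - c)},
    fun _ => 0, LinearMap.toContinuousLinearMap R, hU, hp.2, hU.preimage (by fun_prop), ?_,
    contDiffOn_const, rfl, hasFDerivAt_const _ _, fun v => LinearMap.congr_fun hR v,
    fun v _ => map_zero _, ?_, ?_⟩
  · simpa using hp.2
  · intro v hv
    rw [add_zero]
    refine ⟨⟨?_, hv⟩, hv⟩
    rw [add_sub_right_comm]
    exact W.add_mem hp.1 v.2
  · rintro x ⟨hx, hxU⟩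
    have : x - p ∈ W := by
      have := W.sub_mem hx.1 hp.1
      rwa [sub_sub_sub_cancel_right] at this
    exact ⟨⟨x - p, this⟩, by simpa using hxU, by simp⟩

theorem tangentSpace_geodesicFactor [FiniteDimensional ℝ E] (g : LinearMap.BilinForm ℝ E)
    {W : Submodule ℝ E} {c p : E} (hp : p ∈ geodesicFactor g W a c) :
    tangentSpace (geodesicFactor g W a c) p = W :=
  (isGraphNear_geodesicFactor g hp).tangentSpace_eq

theorem isPseudoRiemannianSubmanifold_factor [FiniteDimensional ℝ E] (h : WarpedData g V a b π)
    (pbar c : E) (j : Fin (k + 1)) :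
    IsPseudoRiemannianSubmanifold g (factor g pbar V a c j) (Module.finrank ℝ (V j)) := by
  induction j using Fin.cases with
  | zero =>
    refine ⟨isEmbeddedSubmanifold_of_isGraphNear (L := fun _ => V 0) (fun _ _ => rfl)
      fun p hp => isGraphNear_geodesicFactor g hp, fun p hp v hv h0 => ?_⟩
    rw [factor_zero, tangentSpace_geodesicFactor g hp] at hv h0
    exact h.nondeg 0 v hv h0
  | succ i =>
    rw [h.factor_succ]
    exact (h.quadricData i).isPseudoRiemannianSubmanifold (h.finrank_subspaceW i)

theorem base_mem_factor (h : WarpedData g V a b π) (pbar : E) (j : Fin (k + 1)) :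
    pbar ∈ factor g pbar V a (pbar - b) j := by
  induction j using Fin.cases with
  | zero => exact ⟨by simpa using h.base_mem, fun i => by simp [h.pairing i]⟩
  | succ i => rw [h.factor_succ]; exact base_mem_quadric pbar _

theorem tangentSpace_factor [FiniteDimensional ℝ E] (h : WarpedData g V a b π)
    (pbar : E) (j : Fin (k + 1)) :
    tangentSpace (factor g pbar V a (pbar - b) j) pbar = V j := by
  have hmem := h.base_mem_factor pbar j
  induction j using Fin.cases with
  | zero => exact tangentSpace_geodesicFactor g hmem
  | succ i =>
    rw [h.factor_succ] at hmem ⊢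
    rw [(h.quadricData i).tangentSpace_eq hmem, sub_self]
    congr 1
    ext v
    rw [mem_quadricTangent, map_zero, LinearMap.zero_apply, add_zero]
    constructor
    · rintro ⟨hv, hb⟩
      obtain ⟨s, u, hu, rfl⟩ := mem_subspaceW.1 hv
      have hs : s = 0 := by
        simpa [h.apply_fiber h.base_mem hu, h.symm b (a i), h.pairing i] using hb
      simpa [hs] using hu
    · exact fun hv => ⟨Submodule.mem_sup_right hv, h.apply_fiber h.base_mem hv⟩

theorem geodesic_open [FiniteDimensional ℝ E] (h : WarpedData g V a b π) (pbar : E) :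
    ∃ U : Set E, IsOpen U ∧
      factor g pbar V a (pbar - b) 0 = sphere g pbar (V 0) 0 ∩ U := by
  refine ⟨{x | ∀ i, 0 < g (a i) (x - (pbar - b))}, ?_, ?_⟩
  · rw [Set.ofPred_forall]
    exact isOpen_iInter_of_finite fun i => isOpen_lt continuous_const
      (continuous_bilin g continuous_const (continuous_id.sub continuous_const))
  · ext x
    rw [factor_zero, sphere, if_pos rfl]
    refine and_congr_left fun _ => ?_
    rw [Set.mem_ofPred_eq, show x - (pbar - b) = x - pbar + b by abel]
    exact (V 0).add_mem_iff_left h.base_mem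

end WarpedData

end WarpedProduct

/-! ### The map `ψ`: inverse, smoothness and metric -/

section WarpedProduct

variable {E : Type*} [NormedAddCommGroup E] [NormedSpace ℝ E]
variable {k : ℕ}

namespace WarpedData

variable {g : LinearMap.BilinForm ℝ E} {V : Fin (k + 1) → Submodule ℝ E}
  {a : Fin k → E} {b : E} {π : Fin (k + 1) → E →ₗ[ℝ] E}

theorem mem_pi_factor (h : WarpedData g V a b π) {pbar c : E} {p : Fin (k + 1) → E} :
    p ∈ Set.univ.pi (factor g pbar V a c) ↔ (p 0 - c ∈ V 0 ∧ ∀ i, 0 < warping g a c i (p 0)) ∧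
      ∀ i : Fin k, p i.succ ∈ quadric g pbar (subspaceW V a i) b := by
  rw [Set.mem_univ_pi, Fin.forall_fin_succ]
  refine and_congr Iff.rfl (forall_congr' fun i => ?_)
  rw [h.factor_succ]

theorem sum_apply_vec (h : WarpedData g V a b π) (i : Fin k) {x₀ : E} (ρ s : Fin k → ℝ)
    {u : Fin k → E} (hu : ∀ i, u i ∈ V i.succ) :
    g (a i) (x₀ + ∑ j, ρ j • (s j • a j + u j)) =
      g (a i) x₀ + ρ i * (g (a i) (a i) * s i) := by
  rw [map_add, map_sum, Finset.sum_eq_single i]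
  · simp only [map_add, map_smul, h.apply_fiber (h.mem i) (hu i), smul_eq_mul]; ring
  · intro j _ hj
    simp only [map_add, map_smul, h.apply_fiber (h.mem i) (hu j), h.orth_vec i j hj.symm,
      smul_eq_mul]; ring
  · simp

theorem proj_sum_fiber (h : WarpedData g V a b π) (i : Fin k) {x₀ : E} (hx₀ : x₀ ∈ V 0)
    (ρ s : Fin k → ℝ) {u : Fin k → E} (hu : ∀ i, u i ∈ V i.succ) :
    π i.succ (x₀ + ∑ j, ρ j • (s j • a j + u j)) = ρ i • u i := by
  have h0 : (0 : Fin (k + 1)) ≠ i.succ := (Fin.succ_ne_zero i).symm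
  rw [map_add, map_sum, h.proj_of_ne h0 hx₀, zero_add, Finset.sum_eq_single i]
  · simp only [map_add, map_smul, h.proj_of_ne h0 (h.mem i), h.proj_self (hu i), smul_zero,
      zero_add]
  · intro j _ hj
    have hj' : j.succ ≠ i.succ := by simpa using hj
    simp only [map_add, map_smul, h.proj_of_ne h0 (h.mem j), h.proj_of_ne hj' (hu j), smul_zero,
      zero_add]
  · simp

/-- With `u = π_i x / ρ`, the coordinate `s` must satisfy `1 + κ s = ⟨a_i, x⟩ / ρ` and the quadric
equation `2 s + κ s² + u² = 0`. For `κ ≠ 0` the first determines `s` and implies the second; for `κ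
= 0` the second determines `s` and the first says `ρ = ⟨a_i, x⟩`, which uses positivity. -/
theorem inverseCoord_spec {i : Fin k} {x : E}
    (hx : 0 < warpingSq g a π i x) (hx' : g (a i) (a i) = 0 → 0 < g (a i) x) :
    g (a i) (a i) * inverseCoord g a π i x = g (a i) x / Real.sqrt (warpingSq g a π i x) - 1 ∧
    2 * inverseCoord g a π i x + g (a i) (a i) * inverseCoord g a π i x ^ 2 +
      g (π i.succ x) (π i.succ x) / warpingSq g a π i x = 0 := by
  rw [inverseCoord]
  split_ifs with hκ
  · have hρ : Real.sqrt (warpingSq g a π i x) = g (a i) x := by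
      rw [warpingSq, hκ, zero_mul, add_zero, Real.sqrt_sq (hx' hκ).le]
    rw [hρ, hκ, div_self (hx' hκ).ne']
    constructor <;> ring
  · have hρ := Real.sq_sqrt hx.le
    have hρ0 := Real.sqrt_pos.2 hx
    set ρ := Real.sqrt (warpingSq g a π i x)
    refine ⟨by field_simp, ?_⟩
    rw [← hρ]
    rw [warpingSq] at hρ
    field_simp
    linear_combination -hρ

theorem psi_sub_base (g : LinearMap.BilinForm ℝ E) (pbar : E) (a : Fin k → E) (c : E)
    (p : Fin (k + 1) → E) :
    psi g pbar a c p - c = (p 0 - c) + ∑ i, warping g a c i (p 0) • (p i.succ - pbar) := by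
  rw [psi]; abel

/-- The other factors contribute neither to `⟨a_i, ·⟩` nor to `π_i`. If `p_i - pbar = s a_i + u`,
these values at `ψ(p) - c` are `ρ (1 + κ s)` and `ρ u`, and `(1 + κ s)² + κ u² = 1` is the quadric
equation multiplied by `κ`. -/
theorem psi_coords (h : WarpedData g V a b π) {pbar c : E} {p : Fin (k + 1) → E}
    (hp : p ∈ Set.univ.pi (factor g pbar V a c)) (i : Fin k) :
    0 < warping g a c i (p 0) ∧
    warpingSq g a π i (psi g pbar a c p - c) = warping g a c i (p 0) ^ 2 ∧
    (g (a i) (a i) = 0 → g (a i) (psi g pbar a c p - c) = warping g a c i (p 0)) ∧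
    inverseFiber g a π i (psi g pbar a c p - c) = p i.succ - pbar := by
  obtain ⟨⟨hp0, hpos⟩, hpi⟩ := h.mem_pi_factor.1 hp
  choose s u hu hsu hQ using fun i => h.mem_quadric.1 (hpi i)
  have hρ := hpos i
  have e0 : psi g pbar a c p - c =
      (p 0 - c) + ∑ j, warping g a c j (p 0) • (s j • a j + u j) := by
    rw [psi_sub_base]; simp only [hsu]
  have e1 := h.sum_apply_vec i (x₀ := p 0 - c) (fun j => warping g a c j (p 0)) s hu
  have e2 := h.proj_sum_fiber i hp0 (fun j => warping g a c j (p 0)) s hu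
  rw [← e0] at e1 e2
  change g (a i) _ = warping g a c i (p 0) + _ at e1
  set x := psi g pbar a c p - c
  set ρ := warping g a c i (p 0)
  have e3 : warpingSq g a π i x = ρ ^ 2 := by
    rw [warpingSq, e1, e2]
    simp only [map_smul, LinearMap.smul_apply, smul_eq_mul]
    linear_combination g (a i) (a i) * ρ ^ 2 * hQ i
  refine ⟨hρ, e3, fun hκ => by rw [e1, hκ]; ring, ?_⟩
  have e4 : inverseCoord g a π i x = s i := by
    rw [inverseCoord, e3, Real.sqrt_sq hρ.le, e1, e2]
    split_ifs with hκ
    · have := hQ i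
      rw [hκ] at this
      simp only [map_smul, LinearMap.smul_apply, smul_eq_mul]
      field_simp
      linear_combination -this
    · field_simp; ring
  rw [inverseFiber, e4, e3, Real.sqrt_sq hρ.le, e2, smul_smul, inv_mul_cancel₀ hρ.ne', one_smul,
    ← hsu]

theorem psi_mem (h : WarpedData g V a b π) {pbar c : E} {p : Fin (k + 1) → E}
    (hp : p ∈ Set.univ.pi (factor g pbar V a c)) : psi g pbar a c p ∈ warpedImage g a π c :=
  fun i => by
    obtain ⟨h1, h2, h3, -⟩ := h.psi_coords hp i
    exact ⟨by rw [h2]; positivity, fun hκ => by rwa [h3 hκ]⟩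

theorem psiInv_psi (h : WarpedData g V a b π) {pbar c : E} {p : Fin (k + 1) → E}
    (hp : p ∈ Set.univ.pi (factor g pbar V a c)) :
    psiInv g pbar a π c (psi g pbar a c p) = p := by
  funext j
  induction j using Fin.cases with
  | zero =>
    have : ∀ i, Real.sqrt (warpingSq g a π i (psi g pbar a c p - c)) •
        inverseFiber g a π i (psi g pbar a c p - c) =
        warping g a c i (p 0) • (p i.succ - pbar) := fun i => by
      obtain ⟨h1, h2, -, h4⟩ := h.psi_coords hp i
      rw [h2, h4, Real.sqrt_sq h1.le]
    simp only [psiInv, Fin.cons_zero, this]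
    simp [psi]
  | succ i =>
    simp only [psiInv, Fin.cons_succ, (h.psi_coords hp i).2.2.2]
    abel

/-- Passing to the zeroth component of the inverse subtracts `ρ κ s = ⟨a_i, q - c⟩ - ρ` from `⟨a_i,
q - c⟩`, leaving `ρ`. Consequently `ψ` adds back exactly the sum that `psiInv` removed. -/
theorem warping_psiInv (h : WarpedData g V a b π) {pbar c q : E} (hq : q ∈ warpedImage g a π c)
    (i : Fin k) : warping g a c i (psiInv g pbar a π c q 0) =
      Real.sqrt (warpingSq g a π i (q - c)) := by
  obtain ⟨h1, h2⟩ := hq i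
  have h3 := (inverseCoord_spec h1 h2).1
  have hρ := Real.sqrt_pos.2 h1
  have e := h.sum_apply_vec i (x₀ := q - c)
    (fun j => -Real.sqrt (warpingSq g a π j (q - c))) (fun j => inverseCoord g a π j (q - c))
    (u := fun j => (Real.sqrt (warpingSq g a π j (q - c)))⁻¹ • π j.succ (q - c))
    (fun j => (V _).smul_mem _ (h.proj_mem _ _))
  rw [h3] at e
  have e0 : psiInv g pbar a π c q 0 - c = (q - c) + ∑ j,
      (-Real.sqrt (warpingSq g a π j (q - c))) • (inverseCoord g a π j (q - c) • a j +
        (Real.sqrt (warpingSq g a π j (q - c)))⁻¹ • π j.succ (q - c)) := by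
    simp only [psiInv, Fin.cons_zero, inverseFiber, neg_smul, Finset.sum_neg_distrib]
    abel
  rw [warping, e0, e]
  field_simp
  ring

theorem psiInv_mem (h : WarpedData g V a b π) {pbar c q : E} (hq : q ∈ warpedImage g a π c) :
    psiInv g pbar a π c q ∈ Set.univ.pi (factor g pbar V a c) := by
  refine h.mem_pi_factor.2 ⟨⟨?_, fun i => ?_⟩, fun i => ?_⟩
  · have e : psiInv g pbar a π c q 0 - c = π 0 (q - c) -
        ∑ i, Real.sqrt (warpingSq g a π i (q - c)) • inverseCoord g a π i (q - c) • a i := by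
      have hs := h.proj_sum (q - c)
      rw [Fin.sum_univ_succ] at hs
      have : ∀ i, Real.sqrt (warpingSq g a π i (q - c)) • inverseFiber g a π i (q - c) =
          Real.sqrt (warpingSq g a π i (q - c)) • inverseCoord g a π i (q - c) • a i +
            π i.succ (q - c) := fun i => by
        rw [inverseFiber, smul_add, smul_smul _ _ (π _ _),
          mul_inv_cancel₀ (Real.sqrt_pos.2 (hq i).1).ne', one_smul]
      simp only [psiInv, Fin.cons_zero, this, Finset.sum_add_distrib]
      rw [sub_right_comm]
      nth_rw 1 [← hs]
      abel
    rw [e]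
    exact (V 0).sub_mem (h.proj_mem _ _) ((V 0).sum_mem fun i _ =>
      (V 0).smul_mem _ ((V 0).smul_mem _ (h.mem i)))
  · rw [h.warping_psiInv hq]
    exact Real.sqrt_pos.2 (hq i).1
  · obtain ⟨h1, h2⟩ := hq i
    refine h.mem_quadric.2 ⟨inverseCoord g a π i (q - c),
      (Real.sqrt (warpingSq g a π i (q - c)))⁻¹ • π i.succ (q - c), (V i.succ).smul_mem _ (h.proj_mem _ _), add_sub_cancel_left _ _, ?_⟩
    rw [← (inverseCoord_spec h1 h2).2]
    simp only [map_smul, LinearMap.smul_apply, smul_eq_mul]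
    rw [← mul_assoc, ← mul_inv, Real.mul_self_sqrt h1.le, inv_mul_eq_div]

theorem psi_psiInv (h : WarpedData g V a b π) {pbar c q : E} (hq : q ∈ warpedImage g a π c) :
    psi g pbar a c (psiInv g pbar a π c q) = q := by
  simp only [psi, h.warping_psiInv hq]
  simp [psiInv]

theorem bijOn_psi (h : WarpedData g V a b π) (pbar c : E) :
    Set.BijOn (psi g pbar a c) (Set.univ.pi (factor g pbar V a c)) (warpedImage g a π c) :=
  Set.InvOn.bijOn (f' := psiInv g pbar a π c)
    ⟨fun _ hp => h.psiInv_psi hp, fun _ hq => h.psi_psiInv hq⟩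
    (fun _ hp => h.psi_mem hp) fun _ hq => h.psiInv_mem hq

theorem bilin_sum_sum (h : WarpedData g V a b π) {X Y : Fin k → E}
    (hX : ∀ i, X i ∈ subspaceW V a i) (hY : ∀ i, Y i ∈ subspaceW V a i) {v w : E}
    (hv : v ∈ V 0) (hw : w ∈ V 0) :
    g (v + ∑ i, X i) (w + ∑ i, Y i) = g v w + ∑ i, (g (a i) v * g b (Y i) +
      g (a i) w * g b (X i) + g (X i) (Y i)) := by
  have h1 : g (∑ i, X i) (∑ i, Y i) = ∑ i, g (X i) (Y i) := by
    rw [map_sum g, LinearMap.sum_apply]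
    refine Finset.sum_congr rfl fun i _ => ?_
    rw [map_sum, Finset.sum_eq_single i (fun j _ hj => h.orth_subspaceW hj.symm (hX i) (hY j))
      (by simp)]
  have h2 : g v (∑ i, Y i) = ∑ i, g (a i) v * g b (Y i) := by
    rw [map_sum]
    exact Finset.sum_congr rfl fun i _ => h.base_apply (hY i) hv
  have h3 : g (∑ i, X i) w = ∑ i, g (a i) w * g b (X i) := by
    rw [h.symm, map_sum]
    exact Finset.sum_congr rfl fun i _ => h.base_apply (hX i) hw
  rw [map_add g, LinearMap.add_apply, map_add, map_add, h1, h2, h3, Finset.sum_add_distrib,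
    Finset.sum_add_distrib]
  ring

section Smoothness

variable [FiniteDimensional ℝ E]

theorem contDiff_psi (g : LinearMap.BilinForm ℝ E) (pbar : E) (a : Fin k → E) (c : E) :
    ContDiff ℝ ∞ (psi g pbar a c) := by
  refine (contDiff_apply ℝ E 0).add (ContDiff.sum fun i _ => ?_)
  exact (contDiff_bilin g contDiff_const ((contDiff_apply ℝ E 0).sub contDiff_const)).smul
    ((contDiff_apply ℝ E i.succ).sub contDiff_const)

theorem contDiff_proj (f : E →ₗ[ℝ] E) (c : E) : ContDiff ℝ ∞ fun q => f (q - c) :=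
  (LinearMap.toContinuousLinearMap f).contDiff.comp (contDiff_id.sub contDiff_const)

theorem contDiff_warpingSq (g : LinearMap.BilinForm ℝ E) (a : Fin k → E)
    (π : Fin (k + 1) → E →ₗ[ℝ] E) (c : E) (i : Fin k) :
    ContDiff ℝ ∞ fun q => warpingSq g a π i (q - c) :=
  ((contDiff_bilin g contDiff_const (contDiff_id.sub contDiff_const)).pow 2).add
    (contDiff_const.mul (contDiff_bilin g (contDiff_proj _ _) (contDiff_proj _ _)))

theorem isOpen_warpedImage (g : LinearMap.BilinForm ℝ E) (a : Fin k → E)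
    (π : Fin (k + 1) → E →ₗ[ℝ] E) (c : E) : IsOpen (warpedImage g a π c) := by
  rw [warpedImage, Set.ofPred_forall]
  refine isOpen_iInter_of_finite fun i => IsOpen.and
    (isOpen_lt continuous_const (contDiff_warpingSq g a π c i).continuous) ?_
  by_cases hκ : g (a i) (a i) = 0
  · simp only [hκ, forall_const]
    exact isOpen_lt continuous_const
      (continuous_bilin g continuous_const (continuous_id.sub continuous_const))
  · simp [hκ]

theorem contDiffOn_psiInv (g : LinearMap.BilinForm ℝ E) (pbar : E) (a : Fin k → E)
    (π : Fin (k + 1) → E →ₗ[ℝ] E) (c : E) :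
    ContDiffOn ℝ ∞ (psiInv g pbar a π c) (warpedImage g a π c) := by
  have hsq : ∀ i, ContDiffOn ℝ ∞ (fun q => warpingSq g a π i (q - c)) (warpedImage g a π c) :=
    fun i => (contDiff_warpingSq g a π c i).contDiffOn
  have hρ : ∀ i, ContDiffOn ℝ ∞ (fun q => Real.sqrt (warpingSq g a π i (q - c)))
      (warpedImage g a π c) := fun i => (hsq i).sqrt fun q hq => (hq i).1.ne'
  have hρ0 : ∀ i, ∀ q ∈ warpedImage g a π c, Real.sqrt (warpingSq g a π i (q - c)) ≠ 0 :=
    fun i q hq => (Real.sqrt_pos.2 (hq i).1).ne'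
  have hpr : ∀ i : Fin k, ContDiffOn ℝ ∞ (fun q => π i.succ (q - c)) (warpedImage g a π c) :=
    fun i => (contDiff_proj _ _).contDiffOn
  have hcoord : ∀ i, ContDiffOn ℝ ∞ (fun q => inverseCoord g a π i (q - c))
      (warpedImage g a π c) := fun i => by
    unfold inverseCoord
    split_ifs with hκ
    · exact (contDiffOn_const.mul (contDiffOn_bilin g (hpr i) (hpr i))).div (hsq i)
        fun q hq => (hq i).1.ne'
    · have hlin : ContDiff ℝ ∞ fun q => g (a i) (q - c) :=
        contDiff_bilin g contDiff_const (contDiff_id.sub contDiff_const)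
      exact ((hlin.contDiffOn.div (hρ i) (hρ0 i)).sub contDiffOn_const).div_const _
  have hfib : ∀ i, ContDiffOn ℝ ∞ (fun q => inverseFiber g a π i (q - c))
      (warpedImage g a π c) := fun i =>
    ((hcoord i).smul contDiffOn_const).add (((hρ i).inv (hρ0 i)).smul (hpr i))
  refine contDiffOn_pi.2 fun j => ?_
  induction j using Fin.cases with
  | zero =>
    simp only [psiInv, Fin.cons_zero]
    exact contDiffOn_id.sub (ContDiffOn.sum fun i _ => (hρ i).smul (hfib i))
  | succ i =>
    simp only [psiInv, Fin.cons_succ]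
    exact contDiffOn_const.add (hfib i)

theorem hasDerivAt_psi_comp (g : LinearMap.BilinForm ℝ E) (pbar : E) (a : Fin k → E) (c : E)
    {γ : ℝ → Fin (k + 1) → E} {γ' : Fin (k + 1) → E} {t : ℝ} (hγ : HasDerivAt γ γ' t) :
    HasDerivAt (psi g pbar a c ∘ γ) (γ' 0 + ∑ i, (warping g a c i (γ t 0) • γ' i.succ +
      g (a i) (γ' 0) • (γ t i.succ - pbar))) t := by
  have hj := hasDerivAt_pi.1 hγ
  refine (hj 0).add (HasDerivAt.fun_sum fun i _ => ?_)
  have h1 := hasDerivAt_bilin g (hasDerivAt_const t (a i)) ((hj 0).sub_const c)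
  rw [map_zero, LinearMap.zero_apply, zero_add] at h1
  exact h1.smul ((hj i.succ).sub_const pbar)

/-- Orthogonality of the `W_i` splits the pairing of the two velocities into one expression per
factor. Each reduces to `ρ² ⟨v, w⟩` by the tangency equations of `v` and `w` (`e1`, `e2`) and the
quadric equation of the point (`e3`). -/
theorem metric_psi (h : WarpedData g V a b π) {pbar c : E} {p : Fin (k + 1) → E}
    (hp : p ∈ Set.univ.pi (factor g pbar V a c)) {γ δ : ℝ → Fin (k + 1) → E}
    (hγ : IsCurveIn (Set.univ.pi (factor g pbar V a c)) p γ)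
    (hδ : IsCurveIn (Set.univ.pi (factor g pbar V a c)) p δ) :
    g (deriv (psi g pbar a c ∘ γ) 0) (deriv (psi g pbar a c ∘ δ) 0) =
      warpedMetric g (warping g a c) p (deriv γ 0) (deriv δ 0) := by
  have htan : ∀ γ, IsCurveIn (Set.univ.pi (factor g pbar V a c)) p γ → ∀ j,
      deriv γ 0 j ∈ tangentSpace (factor g pbar V a c j) (p j) := fun γ hγ j => by
    rw [← (hasDerivAt_pi.1 hγ.hasDerivAt j).deriv]
    exact (hγ.eval j).deriv_mem_tangentSpace
  have htan0 : ∀ γ, IsCurveIn (Set.univ.pi (factor g pbar V a c)) p γ →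
      deriv γ 0 0 ∈ V 0 := fun γ hγ => by
    have := htan γ hγ 0
    rwa [factor_zero, tangentSpace_geodesicFactor g (hp 0 trivial)] at this
  obtain ⟨-, hq⟩ := h.mem_pi_factor.1 hp
  have htani : ∀ γ, IsCurveIn (Set.univ.pi (factor g pbar V a c)) p γ → ∀ i : Fin k,
      deriv γ 0 i.succ ∈ subspaceW V a i ∧
        g b (deriv γ 0 i.succ) + g (p i.succ - pbar) (deriv γ 0 i.succ) = 0 := fun γ hγ i => by
    have := htan γ hγ i.succ
    rw [h.factor_succ, (h.quadricData i).tangentSpace_eq (hq i)] at this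
    exact mem_quadricTangent.1 this
  have hW : ∀ γ, IsCurveIn (Set.univ.pi (factor g pbar V a c)) p γ → ∀ i : Fin k,
      warping g a c i (p 0) • deriv γ 0 i.succ + g (a i) (deriv γ 0 0) • (p i.succ - pbar) ∈
        subspaceW V a i := fun γ hγ i =>
    Submodule.add_mem _ (Submodule.smul_mem _ _ (htani γ hγ i).1)
      (Submodule.smul_mem _ _ (hq i).1)
  have hdγ := hasDerivAt_psi_comp g pbar a c hγ.hasDerivAt
  have hdδ := hasDerivAt_psi_comp g pbar a c hδ.hasDerivAt
  rw [hγ.1] at hdγ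
  rw [hδ.1] at hdδ
  rw [hdγ.deriv, hdδ.deriv, h.bilin_sum_sum (hW γ hγ) (hW δ hδ) (htan0 γ hγ) (htan0 δ hδ),
    warpedMetric]
  congr 1
  refine Finset.sum_congr rfl fun i _ => ?_
  have e1 := (htani γ hγ i).2
  have e2 := (htani δ hδ i).2
  have e3 := (hq i).2
  generalize p i.succ - pbar = x at *
  generalize deriv γ 0 i.succ = v at *
  generalize deriv δ 0 i.succ = w at *
  generalize warping g a c i (p 0) = ρ
  simp only [map_add, map_smul, LinearMap.add_apply, LinearMap.smul_apply, smul_eq_mul,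
    h.symm v x]
  linear_combination ρ * g (a i) (deriv γ 0 0) * e2 + ρ * g (a i) (deriv δ 0 0) * e1 +
    g (a i) (deriv γ 0 0) * g (a i) (deriv δ 0 0) * e3

theorem isWarpedDecomposition (h : WarpedData g V a b π) (pbar : E) :
    IsWarpedDecomposition g pbar V a (pbar - b) (warpedImage g a π (pbar - b)) where
  pseudoRiemannian := h.isPseudoRiemannianSubmanifold_factor pbar _
  mem := h.base_mem_factor pbar
  tangent := h.tangentSpace_factor pbar
  geodesic_open := h.geodesic_open pbar
  spherical i := by
    rw [h.factor_succ]
    exact ⟨_, (h.quadricData i).isSphericalSubmanifold, by simp⟩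
  warping_pos i p₀ hp₀ := ⟨hp₀.2 i, by
    rw [warping, show p₀ - (pbar - b) = b + (p₀ - pbar) by abel, map_add, h.pairing]⟩
  isOpen := isOpen_warpedImage g a π _
  isometry :=
    { bijOn := h.bijOn_psi pbar _
      smooth := isSmoothOn_of_contDiffOn isOpen_univ (Set.subset_univ _)
        (contDiff_psi g pbar a _).contDiffOn
      smooth_inv := ⟨psiInv g pbar a π _, isSmoothOn_of_contDiffOn
        (isOpen_warpedImage g a π _) subset_rfl (contDiffOn_psiInv g pbar a π _),
        fun _ hp => h.psiInv_psi hp⟩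
      metric := fun _ hp _ _ hγ hδ => h.metric_psi hp hγ hδ }

end Smoothness

end WarpedData

end WarpedProduct

/-! ### The image of `ψ` and its density -/

section Image

variable {E : Type*} [NormedAddCommGroup E] [NormedSpace ℝ E]
variable {k : ℕ}

/-- The orthogonal projection onto `W_i` for non-null `a_i`. -/
noncomputable def fiberPart (g : LinearMap.BilinForm ℝ E) (a : Fin k → E)
    (π : Fin (k + 1) → E →ₗ[ℝ] E) (i : Fin k) : E →ₗ[ℝ] E :=
  ((1 / g (a i) (a i)) • g (a i)).smulRight (a i) + π i.succ

theorem fiberPart_apply (g : LinearMap.BilinForm ℝ E) (a : Fin k → E)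
    (π : Fin (k + 1) → E →ₗ[ℝ] E) (i : Fin k) (x : E) :
    fiberPart g a π i x = (1 / g (a i) (a i) * g (a i) x) • a i + π i.succ x := by
  simp [fiberPart]

theorem exists_proj_of_isInternal {V : Fin (k + 1) → Submodule ℝ E}
    (hV : DirectSum.IsInternal V) :
    ∃ π : Fin (k + 1) → E →ₗ[ℝ] E, (∀ j x, π j x ∈ V j) ∧ ∀ x, ∑ j, π j x = x := by
  classical
  let e := LinearEquiv.ofBijective (DirectSum.coeLinearMap V) hV
  refine ⟨fun j => (V j).subtype ∘ₗ DirectSum.component ℝ _ (fun j => V j) j ∘ₗ e.symm.toLinearMap,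
    fun j x => Subtype.property _, fun x => ?_⟩
  conv_rhs => rw [← e.apply_symm_apply x]
  change _ = DirectSum.coeLinearMap V (e.symm x)
  rw [DirectSum.coeLinearMap_eq_dfinsuppSum, DFinsupp.sum_eq_sum_fintype]
  · rfl
  · simp

theorem nondegenerate_of_orthogonal_decomposition {g : LinearMap.BilinForm ℝ E}
    (hnondeg : g.Nondegenerate) {V : Fin (k + 1) → Submodule ℝ E}
    (hVorth : ∀ i j, i ≠ j → ∀ x ∈ V i, ∀ y ∈ V j, g x y = 0)
    {π : Fin (k + 1) → E →ₗ[ℝ] E} (hπ : ∀ j x, π j x ∈ V j) (hsum : ∀ x, ∑ j, π j x = x)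
    (j : Fin (k + 1)) {x : E} (hx : x ∈ V j) (h0 : ∀ y ∈ V j, g x y = 0) : x = 0 := by
  refine hnondeg.1 x fun y => ?_
  rw [← hsum y, map_sum]
  refine Finset.sum_eq_zero fun l _ => ?_
  by_cases hl : l = j
  · subst hl; exact h0 _ (hπ l y)
  · exact hVorth j l (Ne.symm hl) x hx _ (hπ l y)

namespace WarpedData

variable {g : LinearMap.BilinForm ℝ E} {V : Fin (k + 1) → Submodule ℝ E}
  {a : Fin k → E} {b : E} {π : Fin (k + 1) → E →ₗ[ℝ] E}

theorem vec_ne_zero (h : WarpedData g V a b π) (i : Fin k) : a i ≠ 0 := fun h0 => by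
  have := h.pairing i; rw [h0] at this; simp at this

theorem fiberPart_mem (h : WarpedData g V a b π) (i : Fin k) (x : E) :
    fiberPart g a π i x ∈ subspaceW V a i :=
  mem_subspaceW.2 ⟨_, _, h.proj_mem _ _, fiberPart_apply g a π i x⟩

theorem fiberPart_eq_self (h : WarpedData g V a b π) {i : Fin k} (hκ : g (a i) (a i) ≠ 0) {x : E}
    (hx : x ∈ subspaceW V a i) : fiberPart g a π i x = x := by
  obtain ⟨s, u, hu, rfl⟩ := mem_subspaceW.1 hx
  rw [fiberPart_apply, map_add, map_add, h.proj_self hu, map_smul, map_smul,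
    h.proj_of_ne (Fin.succ_ne_zero i).symm (h.mem i), h.apply_fiber (h.mem i) hu, smul_zero,
    zero_add, add_zero, smul_eq_mul]
  congr 2
  field_simp

theorem fiberPart_apply_of_mem (h : WarpedData g V a b π) {i : Fin k} (hκ : g (a i) (a i) ≠ 0)
    (x : E) {y : E} (hy : y ∈ subspaceW V a i) : g y (fiberPart g a π i x) = g y x := by
  obtain ⟨s, u, hu, rfl⟩ := mem_subspaceW.1 hy
  rw [fiberPart_apply]
  simp only [map_add, map_smul, LinearMap.add_apply, LinearMap.smul_apply, smul_eq_mul,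
    h.symm u (a i), h.apply_fiber (h.mem i) hu, h.apply_fiber (h.mem i) (h.proj_mem i.succ x),
    h.symm u (π _ _), h.proj_apply _ x hu, h.symm x u]
  field_simp
  ring

theorem warpingSq_eq (h : WarpedData g V a b π) {i : Fin k} (hκ : g (a i) (a i) ≠ 0) (x : E) :
    warpingSq g a π i x =
      g (a i) (a i) * g (fiberPart g a π i x) (fiberPart g a π i x) := by
  have h1 := h.apply_fiber (h.mem i) (h.proj_mem i.succ x)
  rw [fiberPart_apply, warpingSq]
  simp only [map_add, map_smul, LinearMap.add_apply, LinearMap.smul_apply, smul_eq_mul, h1,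
    h.symm (π _ _) (a i)]
  field_simp
  ring

theorem nondeg_subspaceW (h : WarpedData g V a b π) {i : Fin k} (hκ : g (a i) (a i) ≠ 0) {v : E}
    (hv : v ∈ subspaceW V a i) (h0 : ∀ y ∈ subspaceW V a i, g v y = 0) : v = 0 := by
  refine (h.quadricData i).nondeg v hv h0 ?_
  have h1 := (h.quadricData i).conj v hv
  rw [h.symm, h0 _ (h.quadricData i).mem] at h1
  exact (mul_eq_zero.1 h1.symm).resolve_left hκ

theorem isCompl_subspaceW [FiniteDimensional ℝ E] (h : WarpedData g V a b π) {i : Fin k}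
    (hκ : g (a i) (a i) ≠ 0) :
    IsCompl (subspaceW V a i) (g.orthogonal (subspaceW V a i)) := by
  refine IsCompl.of_eq ?_ ?_
  · rw [eq_bot_iff]
    rintro v ⟨hv, hv'⟩
    refine h.nondeg_subspaceW hκ hv fun y hy => ?_
    rw [h.symm]
    exact LinearMap.BilinForm.mem_orthogonal_iff.1 hv' y hy
  · rw [eq_top_iff]
    intro x _
    refine Submodule.mem_sup.2 ⟨_, h.fiberPart_mem i x, x - fiberPart g a π i x, ?_, by simp⟩
    refine LinearMap.BilinForm.mem_orthogonal_iff.2 fun y hy => ?_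
    rw [map_sub, h.fiberPart_apply_of_mem hκ x hy, sub_self]

theorem orthProj_eq [FiniteDimensional ℝ E] (h : WarpedData g V a b π) {i : Fin k}
    (hκ : g (a i) (a i) ≠ 0) : orthProj g (subspaceW V a i) = fiberPart g a π i := by
  have hc := h.isCompl_subspaceW hκ
  rw [orthProj, dif_pos hc]
  ext x
  have h1 : x - fiberPart g a π i x ∈ g.orthogonal (subspaceW V a i) :=
    LinearMap.BilinForm.mem_orthogonal_iff.2 fun y hy => by
      rw [map_sub, h.fiberPart_apply_of_mem hκ x hy, sub_self]
  have h2 := (Submodule.projection_apply_eq_zero_iff hc).2 h1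
  rw [map_sub, (Submodule.projection_eq_self_iff hc _).2 (h.fiberPart_mem i x)] at h2
  exact sub_eq_zero.1 h2

theorem sign_eq_sign_iff {x κ : ℝ} (hκ : κ ≠ 0) :
    SignType.sign x = SignType.sign κ ↔ 0 < κ * x := by
  rcases hκ.lt_or_gt with hκ | hκ
  · rw [sign_neg hκ, sign_eq_neg_one_iff]
    exact ⟨mul_pos_of_neg_of_neg hκ, fun hx => (neg_iff_neg_of_mul_pos hx).1 hκ⟩
  · rw [sign_pos hκ, sign_eq_one_iff, mul_pos_iff_of_pos_left hκ]

theorem nonNullImage_eq [FiniteDimensional ℝ E] (h : WarpedData g V a b π)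
    (hκ : ∀ i, g (a i) (a i) ≠ 0) (c : E) : nonNullImage g V a c = warpedImage g a π c := by
  ext q
  refine forall_congr' fun i => ?_
  rw [sign_eq_sign_iff (hκ i), h.orthProj_eq (hκ i), h.warpingSq_eq (hκ i)]
  simp [hκ i]

theorem nullImage_eq (hκ : ∀ i, g (a i) (a i) = 0) (c : E) :
    nullImage g a c = warpedImage g a π c := by
  ext q
  refine forall_congr' fun i => ?_
  rw [warpingSq, hκ i, zero_mul, add_zero]
  exact ⟨fun h => ⟨by positivity, fun _ => h⟩, fun h => h.2 rfl⟩

/-- The complement is a proper affine subspace: from an interior point of it a short step along `v`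
with `P v ≠ 0` would stay inside, which is impossible. -/
theorem dense_ne_zero {P : E →ₗ[ℝ] E} (hP : P ≠ 0) (c : E) : Dense {q | P (q - c) ≠ 0} := by
  obtain ⟨v, hv⟩ : ∃ v, P v ≠ 0 := by
    by_contra! h0
    exact hP (LinearMap.ext h0)
  change Dense {q | P (q - c) = 0}ᶜ
  rw [← interior_eq_empty_iff_dense_compl, Set.eq_empty_iff_forall_notMem]
  intro q hq
  have hcont : Continuous fun t : ℝ => q + t • v := by fun_prop
  have hev : ∀ᶠ t in 𝓝 (0 : ℝ), q + t • v ∈ {q | P (q - c) = 0} :=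
    hcont.continuousAt.eventually_mem (by simpa using mem_interior_iff_mem_nhds.1 hq)
  obtain ⟨t, ht, ht0⟩ := ((hev.filter_mono nhdsWithin_le_nhds).and
    (self_mem_nhdsWithin : {(0 : ℝ)}ᶜ ∈ 𝓝[≠] 0)).exists
  have h1 : q ∈ {q | P (q - c) = 0} := interior_subset hq
  rw [Set.mem_ofPred_eq] at h1
  have h2 : P (q + t • v - c) = 0 := ht
  rw [add_sub_right_comm, map_add, h1, zero_add, map_smul] at h2
  exact (smul_ne_zero ht0 hv) h2

variable [FiniteDimensional ℝ E]

theorem warpingSq_nonneg_of_dense {c : E} (hd : Dense (warpedImage g a π c)) (i : Fin k) (x : E) :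
    0 ≤ warpingSq g a π i x := by
  have hcl : IsClosed {q | 0 ≤ warpingSq g a π i (q - c)} :=
    isClosed_le continuous_const (contDiff_warpingSq g a π c i).continuous
  have := hcl.closure_subset_iff.2 (fun q hq => (hq i).1.le) (hd (x + c))
  simpa using this

/-- By continuity density gives `κ_i w² ≥ 0` on all of `W_i`; a null vector of a semidefinite form
lies in its radical, which is trivial here. Conversely, definiteness reduces the sign condition to
`P_i (q - c) ≠ 0`, an open dense condition for each `i`. -/
theorem dense_warpedImage_iff (h : WarpedData g V a b π) (hκ : ∀ i, g (a i) (a i) ≠ 0) (c : E) :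
    Dense (warpedImage g a π c) ↔ ∀ i, IsDefiniteOn g (subspaceW V a i) := by
  have ha : ∀ i, a i ∈ subspaceW V a i := fun i => (h.quadricData i).mem
  constructor
  · intro hd i
    have hnn : ∀ w ∈ subspaceW V a i, 0 ≤ g (a i) (a i) * g w w := fun w hw => by
      have := warpingSq_nonneg_of_dense hd i w
      rwa [h.warpingSq_eq (hκ i), h.fiberPart_eq_self (hκ i) hw] at this
    have hpos : ∀ w ∈ subspaceW V a i, w ≠ 0 → 0 < g (a i) (a i) * g w w := fun w hw hw0 => by
      refine (hnn w hw).lt_of_ne fun he => hw0 (h.nondeg_subspaceW (hκ i) hw fun z hz => ?_)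
      have hww : g w w = 0 := (mul_eq_zero.1 he.symm).resolve_left (hκ i)
      have key : ∀ t : ℝ, 0 ≤ g (a i) (a i) * (2 * t * g w z + g z z) := fun t => by
        have := hnn (t • w + z) (Submodule.add_mem _ (Submodule.smul_mem _ t hw) hz)
        simp only [map_add, map_smul, LinearMap.add_apply, LinearMap.smul_apply, smul_eq_mul,
          h.symm z w, hww] at this
        linarith
      by_contra hwz
      -- This `t` makes `2 t ⟨w, z⟩ + z²` equal to `-1 / κ`, so `key` would assert `0 ≤ -1`.
      have := key (-(g z z + 1 / g (a i) (a i)) / (2 * g w z))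
      have hκi := hκ i
      field_simp at this
      norm_num at this
    rcases (hκ i).lt_or_gt with hn | hp
    · exact Or.inr fun w hw hw0 => (neg_iff_neg_of_mul_pos (hpos w hw hw0)).1 hn
    · exact Or.inl fun w hw hw0 => (mul_pos_iff_of_pos_left hp).1 (hpos w hw hw0)
  · intro hdef
    have hset : warpedImage g a π c = ⋂ i, {q | fiberPart g a π i (q - c) ≠ 0} := by
      ext q
      rw [Set.mem_iInter]
      refine forall_congr' fun i => ?_
      rw [h.warpingSq_eq (hκ i)]
      simp only [hκ i, false_imp_iff, and_true, Set.mem_ofPred_eq]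
      constructor
      · intro hq h0
        rw [h0] at hq
        simp at hq
      · intro hq
        have hm := h.fiberPart_mem i (q - c)
        rcases hdef i with hd | hd
        · exact mul_pos (hd _ (ha i) (h.vec_ne_zero i)) (hd _ hm hq)
        · exact mul_pos_of_neg_of_neg (hd _ (ha i) (h.vec_ne_zero i)) (hd _ hm hq)
    rw [hset]
    refine dense_iInter_of_isOpen (fun i => ?_) fun i => dense_ne_zero (fun h0 => ?_) c
    · exact isOpen_ne_fun (contDiff_proj _ c).continuous continuous_const
    · have := h.fiberPart_eq_self (hκ i) (ha i)
      rw [h0] at this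
      exact h.vec_ne_zero i this.symm

/-- The image lies in a half-space, and `c - b` is strictly on the other side because `⟨a_i, -b⟩ =
-1`. -/
theorem not_dense_nullImage (h : WarpedData g V a b π) (i : Fin k) (c : E) :
    ¬ Dense (nullImage g a c) := by
  intro hd
  have hcl : IsClosed {q | 0 ≤ g (a i) (q - c)} := isClosed_le continuous_const
    (continuous_bilin g continuous_const (continuous_id.sub continuous_const))
  have : 0 ≤ g (a i) (c - b - c) := hcl.closure_subset_iff.2 (fun q hq => (hq i).le) (hd (c - b))
  rw [show c - b - c = -b by abel, map_neg, h.pairing] at this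
  norm_num at this

end WarpedData

/-- A lightlike vector of a non-degenerate subspace has a lightlike dual vector. -/
theorem exists_lightlike_dual {g : LinearMap.BilinForm ℝ E} (hsymm : ∀ x y, g x y = g y x)
    {W : Submodule ℝ E} (hW : ∀ x ∈ W, (∀ y ∈ W, g x y = 0) → x = 0) {a : E} (ha : a ∈ W)
    (ha0 : a ≠ 0) (haa : g a a = 0) : ∃ b ∈ W, g b b = 0 ∧ g a b = 1 := by
  obtain ⟨z, hz, haz⟩ : ∃ z ∈ W, g a z ≠ 0 := by
    by_contra! h0
    exact ha0 (hW a ha h0)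
  -- Scaling `z` normalises its pairing with `a`; subtracting a multiple of `a` then kills the
  -- square without changing the pairing, as `a` is lightlike.
  refine ⟨(g a z)⁻¹ • z - ((g a z)⁻¹ ^ 2 * g z z / 2) • a,
    W.sub_mem (W.smul_mem _ hz) (W.smul_mem _ ha), ?_, ?_⟩
  · simp only [map_sub, map_smul, LinearMap.sub_apply, LinearMap.smul_apply, smul_eq_mul,
      hsymm z a, haa]
    field_simp
    ring
  · simp only [map_sub, map_smul, smul_eq_mul, haa]
    field_simp
    ring

end Image

end WarpedPE

theorem mainTheorem1
    {E : Type*} [NormedAddCommGroup E] [NormedSpace ℝ E] [FiniteDimensional ℝ E]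
    (g : LinearMap.BilinForm ℝ E) (hsymm : g.IsSymm) (hnondeg : g.Nondegenerate)
    (pbar : E) (k : ℕ) (hk : 1 ≤ k)
    (V : Fin (k + 1) → Submodule ℝ E)
    (hV : DirectSum.IsInternal V)
    (hVorth : ∀ i j, i ≠ j → ∀ x ∈ V i, ∀ y ∈ V j, g x y = 0)
    (hVne : ∀ j, V j ≠ ⊥)
    (a : Fin k → E) (ha : ∀ i, a i ∈ V 0)
    (haorth : ∀ i j, i ≠ j → g (a i) (a j) = 0) :
    -- the non-null case
    ((∀ i, g (a i) (a i) ≠ 0) →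
      (∀ i, IsCompl (WarpedPE.subspaceW V a i) (g.orthogonal (WarpedPE.subspaceW V a i))) ∧
      WarpedPE.IsWarpedDecomposition g pbar V a (WarpedPE.centre g pbar a)
        (WarpedPE.nonNullImage g V a (WarpedPE.centre g pbar a)) ∧
      (Dense (WarpedPE.nonNullImage g V a (WarpedPE.centre g pbar a)) ↔
        ∀ i, WarpedPE.IsDefiniteOn g (WarpedPE.subspaceW V a i))) ∧
    -- the null case
    (k = 1 → (∀ i, a i ≠ 0 ∧ g (a i) (a i) = 0) →
      (∃ b ∈ V 0, g b b = 0 ∧ ∀ i, g (a i) b = 1) ∧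
      ∀ b ∈ V 0, g b b = 0 → (∀ i, g (a i) b = 1) →
        WarpedPE.IsWarpedDecomposition g pbar V a (pbar - b)
          (WarpedPE.nullImage g a (pbar - b)) ∧
        ¬ Dense (WarpedPE.nullImage g a (pbar - b))) := by
  obtain ⟨π, hπ, hsum⟩ := WarpedPE.exists_proj_of_isInternal hV
  have hnd : ∀ j, ∀ x ∈ V j, (∀ y ∈ V j, g x y = 0) → x = 0 := fun j x hx h0 =>
    WarpedPE.nondegenerate_of_orthogonal_decomposition hnondeg hVorth hπ hsum j hx h0
  have hdata : ∀ b ∈ V 0, (∀ i, g (a i) b = 1) → WarpedPE.WarpedData g V a b π :=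
    fun b hb hab => ⟨hsymm.eq, hVorth, hnd, ha, haorth, hb, hab, hπ, hsum⟩
  refine ⟨fun hκ => ?_, fun hk1 hnull => ⟨?_, fun b hb _ hab => ⟨?_, ?_⟩⟩⟩
  -- For this `b`, `pbar - b` is `centre g pbar a` by definition, and orthogonality of the `a_i`
  -- gives `⟨a_i, b⟩ = 1`.
  · have h := hdata (∑ i, (1 / g (a i) (a i)) • a i)
      ((V 0).sum_mem fun i _ => (V 0).smul_mem _ (ha i)) fun i => by
        rw [map_sum, Finset.sum_eq_single i]
        · rw [map_smul, smul_eq_mul, one_div, inv_mul_cancel₀ (hκ i)]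
        · intro j _ hj
          rw [map_smul, haorth i j hj.symm, smul_zero]
        · simp
    rw [h.nonNullImage_eq hκ]
    exact ⟨fun i => h.isCompl_subspaceW (hκ i), h.isWarpedDecomposition pbar,
      h.dense_warpedImage_iff hκ _⟩
  · subst hk1
    obtain ⟨b, hb, hbb, hab⟩ := WarpedPE.exists_lightlike_dual hsymm.eq (hnd 0) (ha 0)
      (hnull 0).1 (hnull 0).2
    exact ⟨b, hb, hbb, fun i => by rw [Subsingleton.elim i 0]; exact hab⟩
  · rw [WarpedPE.WarpedData.nullImage_eq (π := π) fun i => (hnull i).2]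
    exact (hdata b hb hab).isWarpedDecomposition pbar
  · exact (hdata b hb hab).not_dense_nullImage ⟨0, hk⟩ _
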